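/- Let $\varepsilon>0$ and $\delta>0$ be fixed constants, and let $p=p(n)\in[0,1]$ satisfy $n^{-1/3+\delta}\le p\le 1/2$ for all sufficiently large $n$. Let $G(n,p)$ be the binomial random graph on $n$ labelled vertices, in which each pair of vertices is an edge independently with probability $p$; put $b=1/(1-p)$, let $\log$ denote the natural logarithm, and let $\chi$ denote the chromatic number. Then, with probability tending to $1$ as $n\to\infty$, the graph $G=G(n,p)$ satisfies both of the following. 1. For every set $E$ of at most $2^{-12}\varepsilon^2\,\dfrac{n^2}{(\log_b(np))^2}$ pairs of distinct vertices, $$\chi(G\cup E)\le(1+\varepsilon)\frac{n}{2\log_b(np)}.$$ 2. For every graph $H$ on the same vertex set with maximum degree $\Delta(H)\le 2^{-8}\varepsilon\,\dfrac{n}{\log_b(np)\,\log\log n}$, $$\chi(G\cup H)\le(1+\varepsilon)\frac{n}{2\log_b(np)}.$$ -/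

import Mathlib

open Filter Topology

/-- The chromatic number of a graph on `n` vertices, as a natural number (it is finite, see
`coe_chi`). -/
noncomputable def chi {n : ℕ} (G : SimpleGraph (Fin n)) : ℕ :=
  G.chromaticNumber.toNat

theorem coe_chi {n : ℕ} (G : SimpleGraph (Fin n)) : (chi G : ℕ∞) = G.chromaticNumber :=
  ENat.natCast_toNat (SimpleGraph.chromaticNumber_ne_top_iff_exists.2
    ⟨n, by simpa using G.colorable_of_fintype⟩)

/-- Asymptotically almost surely: the probability that the binomial random graph `G(n, p n)` on
the vertex set `Fin n` satisfies `P n` tends to `1` as `n → ∞`. -/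
def AAS (p : ℕ → unitInterval) (P : (n : ℕ) → SimpleGraph (Fin n) → Prop) : Prop :=
  Tendsto (fun n : ℕ => SimpleGraph.binomialRandom (Fin n) (p n) {G | P n G}) atTop (𝓝 1)

/-- `log_b (np)` with base `b = 1 / (1 - p)`. -/
noncomputable def logbNP (n : ℕ) (p : ℝ) : ℝ :=
  Real.logb (1 / (1 - p)) (n * p)

/-- The bound `(1 + ε) n / (2 log_b (np))` on the chromatic number. -/
noncomputable def chiBound (ε : ℝ) (n : ℕ) (p : ℝ) : ℝ :=
  (1 + ε) * (n / (2 * logbNP n p))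

/-- Adding any collection `E` of at most `2⁻¹² ε² n² / log_b² (np)` edges (pairs of distinct
vertices, possibly already edges of `G`) keeps the chromatic number at most
`(1 + ε) n / (2 log_b (np))`. -/
def GloballyResilient (ε : ℝ) (n : ℕ) (p : ℝ) (G : SimpleGraph (Fin n)) : Prop :=
  ∀ E : Finset (Sym2 (Fin n)), (∀ e ∈ E, ¬ e.IsDiag) →
    (E.card : ℝ) ≤ (2 : ℝ)⁻¹ ^ 12 * ε ^ 2 * ((n : ℝ) ^ 2 / logbNP n p ^ 2) →
    (chi (G ⊔ SimpleGraph.fromEdgeSet (E : Set (Sym2 (Fin n)))) : ℝ) ≤ chiBound ε n p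

open Classical in
/-- Adding any graph `H` on the same vertices with maximum degree at most
`2⁻⁸ ε n / (log_b (np) log log n)` keeps the chromatic number at most
`(1 + ε) n / (2 log_b (np))`. -/
def LocallyResilient (ε : ℝ) (n : ℕ) (p : ℝ) (G : SimpleGraph (Fin n)) : Prop :=
  ∀ H : SimpleGraph (Fin n),
    (H.maxDegree : ℝ) ≤
      (2 : ℝ)⁻¹ ^ 8 * ε * ((n : ℝ) / (logbNP n p * Real.log (Real.log n))) →
    (chi (G ⊔ H) : ℝ) ≤ chiBound ε n p

/-! Fix `k` slightly below `2 log_b(np)` and put `s₀ = εn/(16 log n)`. In every vertex set `S` with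
at least `s₀` vertices one wants not just one independent `k`-set of `G` but so many of them, spread
so evenly over the pairs of `S`, that a sparse graph `H` cannot spoil them all. The robust measure
is the fractional packing number `ν(S)`: the largest total weight on independent `k`-sets of `S` for
which every pair is covered with weight at most 1.

Random part. A second moment computation gives `E ν(S) ≥ |S|²/(8k²)`
(`le_bernoulliExp_fracPackingNumber_pairs`, with the variance estimate
`two_mul_sq_mul_overlapBound_le`). Changing one pair of `G` alters `ν(S)` by at most 1, so
`bernoulliExp_tail_le`, whose variance term carries a factor `p`, yields `ν(S) > |S|²/(16k²)` except
with probability `exp(-2n)`. This survives a union bound over all `2^n` sets. Both the variance and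
the concentration estimate need `p³n` to exceed powers of `log n`; this is the origin of the
exponent `-1/3`.

Deterministic part. Averaging `e_H` over a packing gives an independent `k`-set `K` of `G` with
`e_H(K) ≤ 16k² e_H(S)/|S|²`, and Caro–Wei inside `K` gives a set independent in `G ∪ H` of size at
least `k/(1+D)`, where `D` bounds `32k e_H(S)/|S|²` (`IsTypical.exists_indep`). Extracting such sets
until at most `s₀` vertices remain costs about `(n + ∫ D(s) ds)/k` colours, with the integral from
`s₀` to `n`. For a bounded number of added edges `D` is of order `1/s²` and the integral is
`O(1/s₀)`; for bounded degree `D` is of order `1/s` and the integral is logarithmic in `n/s₀`, hence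
the `log log n`. The remainder is coloured greedily, since the typical `G` and `H` are both sparse
on it. -/

/-- The expectation of `f A`, where `A` is a random subset of `U` that contains each element
independently with probability `p`. -/
noncomputable def bernoulliExp {ι : Type*} (p : ℝ) (U : Finset ι) (f : Finset ι → ℝ) : ℝ :=
  ∑ A ∈ U.powerset, p ^ A.card * (1 - p) ^ (U.card - A.card) * f A

/-! ### Product Bernoulli expectations and concentration -/

section BernoulliExp

variable {ι : Type*} {p : ℝ} {U : Finset ι} {f g : Finset ι → ℝ}

theorem bernoulliExp_congr (h : ∀ A ⊆ U, f A = g A) :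
    bernoulliExp p U f = bernoulliExp p U g :=
  Finset.sum_congr rfl fun A hA => by rw [h A (Finset.mem_powerset.1 hA)]

theorem bernoulliExp_mono (hp0 : 0 ≤ p) (hp1 : p ≤ 1) (h : ∀ A ⊆ U, f A ≤ g A) :
    bernoulliExp p U f ≤ bernoulliExp p U g := by
  have : 0 ≤ 1 - p := by linarith
  exact Finset.sum_le_sum fun A hA =>
    mul_le_mul_of_nonneg_left (h A (Finset.mem_powerset.1 hA)) (by positivity)

theorem bernoulliExp_add :
    bernoulliExp p U (fun A => f A + g A) = bernoulliExp p U f + bernoulliExp p U g := by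
  simp only [bernoulliExp, mul_add, Finset.sum_add_distrib]

theorem bernoulliExp_sub :
    bernoulliExp p U (fun A => f A - g A) = bernoulliExp p U f - bernoulliExp p U g := by
  simp only [bernoulliExp, mul_sub, Finset.sum_sub_distrib]

theorem bernoulliExp_const_mul (c : ℝ) :
    bernoulliExp p U (fun A => c * f A) = c * bernoulliExp p U f := by
  simp only [bernoulliExp, Finset.mul_sum]
  exact Finset.sum_congr rfl fun A _ => by ring

theorem bernoulliExp_sum {α : Type*} (s : Finset α) (F : α → Finset ι → ℝ) :
    bernoulliExp p U (fun A => ∑ a ∈ s, F a A) = ∑ a ∈ s, bernoulliExp p U (F a) := by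
  simp only [bernoulliExp, Finset.mul_sum]
  exact Finset.sum_comm

theorem bernoulliExp_empty : bernoulliExp p ∅ f = f ∅ := by
  simp [bernoulliExp]

variable [DecidableEq ι]

/-- Conditioning on whether `a` is chosen. This is the step of every induction on the ground set,
including the martingale argument of `bernoulliExp_mgf_le`. -/
theorem bernoulliExp_insert {a : ι} (ha : a ∉ U) :
    bernoulliExp p (insert a U) f =
      bernoulliExp p U (fun A => (1 - p) * f A + p * f (insert a A)) := by
  unfold bernoulliExp
  rw [Finset.sum_powerset_insert ha, ← Finset.sum_add_distrib]
  refine Finset.sum_congr rfl fun A hA => ?_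
  have hAU := Finset.mem_powerset.1 hA
  have hc := Finset.card_le_card hAU
  rw [Finset.card_insert_of_notMem ha, Finset.card_insert_of_notMem fun h => ha (hAU h),
    Nat.add_sub_add_right, Nat.sub_add_comm hc]
  ring

theorem bernoulliExp_const (c : ℝ) : bernoulliExp p U (fun _ => c) = c := by
  induction U using Finset.induction_on with
  | empty => exact bernoulliExp_empty
  | insert a U ha ih =>
    rw [bernoulliExp_insert ha]
    convert ih using 3
    ring

/-- The probability that the random set avoids `J`. -/
theorem bernoulliExp_disjoint {J : Finset ι} (hJ : J ⊆ U) :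
    bernoulliExp p U (fun A => if Disjoint J A then 1 else 0) = (1 - p) ^ J.card := by
  induction U using Finset.induction_on generalizing J with
  | empty => simp [bernoulliExp_empty, Finset.subset_empty.1 hJ]
  | insert a U ha ih =>
    rw [bernoulliExp_insert ha]
    by_cases haJ : a ∈ J
    · have h1 : J.erase a ⊆ U := by
        intro x hx
        rcases Finset.mem_insert.1 (hJ (Finset.mem_of_mem_erase hx)) with h | h
        · exact absurd h (Finset.ne_of_mem_erase hx)
        · exact h
      rw [← Finset.card_erase_add_one haJ, pow_succ, ← ih h1, mul_comm _ (1 - p),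
        ← bernoulliExp_const_mul]
      refine bernoulliExp_congr fun A hA => ?_
      have h2 : ¬ Disjoint J (insert a A) := by
        rw [Finset.disjoint_insert_right]; tauto
      have h3 : Disjoint J A ↔ Disjoint (J.erase a) A := by
        have : J = insert a (J.erase a) := (Finset.insert_erase haJ).symm
        rw [this, Finset.disjoint_insert_left, Finset.erase_insert (Finset.notMem_erase _ _)]
        exact ⟨fun h => h.2, fun h => ⟨fun h' => ha (hA h'), h⟩⟩
      simp [h2, h3]
    · have h1 : J ⊆ U := fun x hx => by
        rcases Finset.mem_insert.1 (hJ hx) with h | h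
        · exact absurd (h ▸ hx) haJ
        · exact h
      rw [← ih h1]
      refine bernoulliExp_congr fun A _ => ?_
      have h2 : Disjoint J (insert a A) ↔ Disjoint J A := by
        rw [Finset.disjoint_insert_right]; tauto
      simp only [h2]; ring

theorem bernoulliExp_card_inter {J : Finset ι} (hJ : J ⊆ U) :
    bernoulliExp p U (fun A => ((J ∩ A).card : ℝ)) = p * J.card := by
  have h1 : ∀ A : Finset ι, ((J ∩ A).card : ℝ) =
      ∑ e ∈ J, (1 - if Disjoint {e} A then 1 else 0) := by
    intro A
    rw [← Finset.filter_mem_eq_inter, Finset.card_filter, Nat.cast_sum]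
    refine Finset.sum_congr rfl fun e _ => ?_
    by_cases h : e ∈ A <;> simp [h]
  simp_rw [h1]
  rw [bernoulliExp_sum, Finset.sum_congr rfl (g := fun _ => p), Finset.sum_const, nsmul_eq_mul,
    mul_comm]
  intro e he
  rw [bernoulliExp_sub, bernoulliExp_const,
    bernoulliExp_disjoint (Finset.singleton_subset_iff.2 (hJ he))]
  simp

theorem exp_le_one_add_add_sq {x : ℝ} (hx : |x| ≤ 1) : Real.exp x ≤ 1 + x + x ^ 2 := by
  have := abs_le.1 (Real.abs_exp_sub_one_sub_id_le hx)
  linarith [this.2]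

/-- Moment generating function of a centred two-point variable. -/
theorem two_point_mgf (hp0 : 0 ≤ p) (hp1 : p ≤ 1) {x y l c : ℝ} (hc : c ≤ 1)
    (hxy : |y - x| ≤ c) (hl : |l| ≤ 1) :
    (1 - p) * Real.exp (l * (x - ((1 - p) * x + p * y))) +
      p * Real.exp (l * (y - ((1 - p) * x + p * y))) ≤ Real.exp (l ^ 2 * p * c ^ 2) := by
  set d := y - x with hd
  have h1 : x - ((1 - p) * x + p * y) = -(p * d) := by rw [hd]; ring
  have h2 : y - ((1 - p) * x + p * y) = (1 - p) * d := by rw [hd]; ring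
  rw [h1, h2]
  have hd1 : |l * d| ≤ 1 := by
    rw [abs_mul]
    exact mul_le_one₀ hl (abs_nonneg _) (hxy.trans hc)
  have hq : 0 ≤ 1 - p := by linarith
  have e1 := exp_le_one_add_add_sq (x := l * -(p * d)) (by
    rw [show l * -(p * d) = -p * (l * d) by ring, abs_mul, abs_neg, abs_of_nonneg hp0]
    exact mul_le_one₀ hp1 (abs_nonneg _) hd1)
  have e2 := exp_le_one_add_add_sq (x := l * ((1 - p) * d)) (by
    rw [show l * ((1 - p) * d) = (1 - p) * (l * d) by ring, abs_mul, abs_of_nonneg hq]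
    exact mul_le_one₀ (by linarith) (abs_nonneg _) hd1)
  have hdc : d ^ 2 ≤ c ^ 2 := by
    rw [← sq_abs d]
    exact pow_le_pow_left₀ (abs_nonneg _) hxy 2
  calc _ ≤ (1 - p) * (1 + l * -(p * d) + (l * -(p * d)) ^ 2) +
        p * (1 + l * ((1 - p) * d) + (l * ((1 - p) * d)) ^ 2) := by gcongr
    _ = 1 + l ^ 2 * (p * (1 - p)) * d ^ 2 := by ring
    -- The linear terms have cancelled because the variable is centred. Keeping the variance factor
    -- `p` here, which a worst-case bounded differences estimate would lose, is what makes sparse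
    -- `p` accessible.
    _ ≤ 1 + l ^ 2 * p * c ^ 2 := by
        have : p * (1 - p) ≤ p := by nlinarith
        gcongr
    _ ≤ _ := by linarith [Real.add_one_le_exp (l ^ 2 * p * c ^ 2)]

/-- A Bernstein-type bound for functions of independent Bernoulli variables with bounded
differences. -/
theorem bernoulliExp_mgf_le (hp0 : 0 ≤ p) (hp1 : p ≤ 1) {c : ι → ℝ} {l : ℝ}
    (hc : ∀ a, c a ≤ 1) (hl : |l| ≤ 1) (hf : ∀ a A, |f (insert a A) - f A| ≤ c a) :
    bernoulliExp p U (fun A => Real.exp (l * (f A - bernoulliExp p U f))) ≤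
      Real.exp (l ^ 2 * p * ∑ a ∈ U, c a ^ 2) := by
  induction U using Finset.induction_on generalizing f with
  | empty => simp [bernoulliExp_empty]
  | insert a U ha ih =>
    have hq : 0 ≤ 1 - p := by linarith
    rw [bernoulliExp_insert ha, bernoulliExp_insert ha]
    -- `g` averages `f` over the choice of `a`; it has the same mean and inherits the difference
    -- bounds, so the exponential moment factors into the contribution of `a` and that of `U`.
    set g : Finset ι → ℝ := fun A => (1 - p) * f A + p * f (insert a A) with hg
    have hgl : ∀ b A, |g (insert b A) - g A| ≤ c b := by
      intro b A
      have h1 : g (insert b A) - g A = (1 - p) * (f (insert b A) - f A) +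
          p * (f (insert b (insert a A)) - f (insert a A)) := by
        simp only [hg, Finset.insert_comm a b]; ring
      rw [h1]
      calc _ ≤ |(1 - p) * (f (insert b A) - f A)| +
            |p * (f (insert b (insert a A)) - f (insert a A))| := abs_add_le _ _
        _ ≤ (1 - p) * c b + p * c b := by
            rw [abs_mul, abs_mul, abs_of_nonneg hq, abs_of_nonneg hp0]
            gcongr
            · exact hf b A
            · exact hf b _
        _ = c b := by ring
    have := ih hgl
    rw [Finset.sum_insert ha, mul_add, Real.exp_add]
    set m := bernoulliExp p U g
    calc _ ≤ bernoulliExp p U (fun A => Real.exp (l ^ 2 * p * c a ^ 2) *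
          Real.exp (l * (g A - m))) := by
          refine bernoulliExp_mono hp0 hp1 fun A _ => ?_
          have h2 : ∀ z, Real.exp (l * (z - m)) =
              Real.exp (l * (z - g A)) * Real.exp (l * (g A - m)) := by
            intro z; rw [← Real.exp_add]; ring_nf
          rw [h2 (f A), h2 (f (insert a A)), ← mul_assoc, ← mul_assoc, ← add_mul]
          exact mul_le_mul_of_nonneg_right (two_point_mgf hp0 hp1 (hc a) (hf a A) hl)
            (Real.exp_nonneg _)
      _ ≤ _ := by
          rw [bernoulliExp_const_mul]
          gcongr

open Classical in
/-- Exponential Markov inequality for `bernoulliExp`. -/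
theorem bernoulliExp_tail_le (hp0 : 0 ≤ p) (hp1 : p ≤ 1) {c : ι → ℝ} {l t : ℝ}
    (hc : ∀ a, c a ≤ 1) (hl : |l| ≤ 1) (hf : ∀ a A, |f (insert a A) - f A| ≤ c a) :
    bernoulliExp p U (fun A => if t ≤ l * (f A - bernoulliExp p U f) then 1 else 0) ≤
      Real.exp (l ^ 2 * p * ∑ a ∈ U, c a ^ 2 - t) := by
  calc _ ≤ bernoulliExp p U (fun A => Real.exp (-t) *
        Real.exp (l * (f A - bernoulliExp p U f))) := by
        refine bernoulliExp_mono hp0 hp1 fun A _ => ?_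
        rw [← Real.exp_add]
        split_ifs with h
        · exact Real.one_le_exp (by linarith)
        · positivity
    _ ≤ Real.exp (-t) * Real.exp (l ^ 2 * p * ∑ a ∈ U, c a ^ 2) := by
        rw [bernoulliExp_const_mul]
        gcongr
        exact bernoulliExp_mgf_le hp0 hp1 hc hl hf
    _ = _ := by rw [← Real.exp_add]; ring_nf

end BernoulliExp

/-! ### Fractional packings and the second moment method -/

section FracPacking

variable {ι α : Type*} [DecidableEq ι]

/-- A fractional packing of the blocks `Q K`, `K ∈ 𝒦`, that are disjoint from `A`: every element
is covered with total weight at most `1`. -/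
structure IsFracPacking (𝒦 : Finset α) (Q : α → Finset ι) (A : Finset ι) (w : α → ℝ) : Prop where
  nonneg : ∀ K, 0 ≤ w K
  eq_zero : ∀ K ∈ 𝒦, ¬ Disjoint (Q K) A → w K = 0
  cover_le : ∀ e, ∑ K ∈ 𝒦 with e ∈ Q K, w K ≤ 1

/-- The largest total weight of a fractional packing. -/
noncomputable def fracPackingNumber (𝒦 : Finset α) (Q : α → Finset ι) (A : Finset ι) : ℝ :=
  sSup {x | ∃ w, IsFracPacking 𝒦 Q A w ∧ x = ∑ K ∈ 𝒦, w K}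

variable {𝒦 : Finset α} {Q : α → Finset ι} {A : Finset ι} {w : α → ℝ}

theorem fracPacking_bddAbove (hQ : ∀ K ∈ 𝒦, (Q K).Nonempty) :
    BddAbove {x | ∃ w, IsFracPacking 𝒦 Q A w ∧ x = ∑ K ∈ 𝒦, w K} := by
  refine ⟨𝒦.card, ?_⟩
  rintro x ⟨w, hw, rfl⟩
  rw [← nsmul_one 𝒦.card]
  refine Finset.sum_le_card_nsmul _ _ _ fun K hK => ?_
  obtain ⟨e, he⟩ := hQ K hK
  exact (Finset.single_le_sum (f := w) (fun K _ => hw.nonneg K)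
    (Finset.mem_filter.2 ⟨hK, he⟩)).trans (hw.cover_le e)

theorem IsFracPacking.le (hQ : ∀ K ∈ 𝒦, (Q K).Nonempty) (hw : IsFracPacking 𝒦 Q A w) :
    ∑ K ∈ 𝒦, w K ≤ fracPackingNumber 𝒦 Q A :=
  le_csSup (fracPacking_bddAbove hQ) ⟨w, hw, rfl⟩

theorem isFracPacking_zero : IsFracPacking 𝒦 Q A fun _ => 0 :=
  ⟨fun _ => le_rfl, fun _ _ _ => rfl, fun _ => by simp⟩

theorem fracPackingNumber_le {x : ℝ} (h : ∀ w, IsFracPacking 𝒦 Q A w → ∑ K ∈ 𝒦, w K ≤ x) :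
    fracPackingNumber 𝒦 Q A ≤ x := by
  refine csSup_le ⟨_, _, isFracPacking_zero, rfl⟩ ?_
  rintro y ⟨w, hw, rfl⟩
  exact h w hw

theorem exists_isFracPacking_of_lt {x : ℝ} (h : x < fracPackingNumber 𝒦 Q A) :
    ∃ w, IsFracPacking 𝒦 Q A w ∧ x < ∑ K ∈ 𝒦, w K := by
  have hne : {x | ∃ w, IsFracPacking 𝒦 Q A w ∧ x = ∑ K ∈ 𝒦, w K}.Nonempty :=
    ⟨_, _, isFracPacking_zero, rfl⟩
  obtain ⟨y, ⟨w, hw, rfl⟩, hy⟩ := exists_lt_of_lt_csSup hne h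
  exact ⟨w, hw, hy⟩

/-- Adding `a` to the forbidden set destroys only the blocks through `a`, and the covering
constraint at `a` limits their total weight to 1. This Lipschitz property is the reason for counting
packings rather than all independent sets. -/
theorem abs_fracPackingNumber_insert_sub_le (hQ : ∀ K ∈ 𝒦, (Q K).Nonempty) (a : ι) :
    |fracPackingNumber 𝒦 Q (insert a A) - fracPackingNumber 𝒦 Q A| ≤ 1 := by
  have h1 : fracPackingNumber 𝒦 Q (insert a A) ≤ fracPackingNumber 𝒦 Q A := by
    refine fracPackingNumber_le fun w hw => ?_
    have hw' : IsFracPacking 𝒦 Q A w := ⟨hw.nonneg, fun K hK h => hw.eq_zero K hK fun h' =>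
      h (h'.mono_right (Finset.subset_insert _ _)), hw.cover_le⟩
    exact hw'.le hQ
  have h2 : fracPackingNumber 𝒦 Q A ≤ fracPackingNumber 𝒦 Q (insert a A) + 1 := by
    refine fracPackingNumber_le fun w hw => ?_
    have hw' : IsFracPacking 𝒦 Q (insert a A) fun K => if a ∈ Q K then 0 else w K := by
      refine ⟨fun K => ?_, fun K hK h => ?_, fun e => ?_⟩
      · split_ifs
        exacts [le_rfl, hw.nonneg K]
      · split_ifs with ha
        · rfl
        · refine hw.eq_zero K hK fun h' => h ?_
          exact Finset.disjoint_insert_right.2 ⟨ha, h'⟩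
      · refine le_trans (Finset.sum_le_sum fun K _ => ?_) (hw.cover_le e)
        split_ifs
        exacts [hw.nonneg K, le_rfl]
    have h3 : ∑ K ∈ 𝒦, w K = ∑ K ∈ 𝒦, (if a ∈ Q K then 0 else w K) +
        ∑ K ∈ 𝒦 with a ∈ Q K, w K := by
      rw [Finset.sum_filter, ← Finset.sum_add_distrib]
      exact Finset.sum_congr rfl fun K _ => by split_ifs <;> simp
    rw [h3]
    exact add_le_add (hw'.le hQ) (hw.cover_le a)
  rw [abs_le]
  constructor <;> linarith

/-- The number of blocks through `e` that are disjoint from `A`. -/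
noncomputable def blockDegree (𝒦 : Finset α) (Q : α → Finset ι) (A : Finset ι) (e : ι) : ℝ :=
  ∑ K ∈ 𝒦 with e ∈ Q K, if Disjoint (Q K) A then 1 else 0

theorem blockDegree_eq_zero {e : ι} (he : e ∈ A) : blockDegree 𝒦 Q A e = 0 := by
  refine Finset.sum_eq_zero fun K hK => if_neg fun h => ?_
  exact Finset.disjoint_left.1 h (Finset.mem_filter.1 hK).2 he

open Classical in
/-- Giving weight `1 / (2 M)` to the blocks all of whose elements have degree at most `2 M` is a
fractional packing. -/
theorem sub_le_two_mul_fracPackingNumber {W : Finset ι} {M : ℝ} (hM : 0 < M)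
    (hQ : ∀ K ∈ 𝒦, (Q K).Nonempty) (hW : ∀ K ∈ 𝒦, Q K ⊆ W) :
    (∑ K ∈ 𝒦, if Disjoint (Q K) A then (1 : ℝ) else 0) -
      ∑ e ∈ W, (if 2 * M < blockDegree 𝒦 Q A e then blockDegree 𝒦 Q A e else 0) ≤
      2 * M * fracPackingNumber 𝒦 Q A := by
  set good : α → Prop := fun K => Disjoint (Q K) A ∧ ∀ e ∈ Q K, blockDegree 𝒦 Q A e ≤ 2 * M
  have hw : IsFracPacking 𝒦 Q A fun K => if good K then 1 / (2 * M) else 0 := by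
    refine ⟨fun K => ?_, fun K _ h => if_neg fun h' => h h'.1, fun e => ?_⟩
    · split_ifs <;> positivity
    · by_cases he : blockDegree 𝒦 Q A e ≤ 2 * M
      · calc _ ≤ ∑ K ∈ 𝒦 with e ∈ Q K, 1 / (2 * M) * (if Disjoint (Q K) A then 1 else 0) := by
              refine Finset.sum_le_sum fun K _ => ?_
              by_cases hd : Disjoint (Q K) A
              · rw [if_pos hd]
                split_ifs
                · simp
                · positivity
              · rw [if_neg hd, if_neg fun h => hd h.1]; simp
          _ = 1 / (2 * M) * blockDegree 𝒦 Q A e := by rw [← Finset.mul_sum]; rfl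
          _ ≤ 1 := by rw [one_div, inv_mul_le_one₀ (by positivity)]; exact he
      · rw [Finset.sum_eq_zero]
        · norm_num
        · intro K hK
          exact if_neg fun h => he (h.2 e (Finset.mem_filter.1 hK).2)
  have h1 := hw.le hQ
  have h2 : (∑ K ∈ 𝒦, if Disjoint (Q K) A then (1 : ℝ) else 0) ≤
      ∑ K ∈ 𝒦, ((if good K then 1 else 0) + ∑ e ∈ W,
        if e ∈ Q K ∧ 2 * M < blockDegree 𝒦 Q A e then
          (if Disjoint (Q K) A then (1 : ℝ) else 0) else 0) := by
    refine Finset.sum_le_sum fun K hK => ?_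
    have h0 : ∀ e ∈ W, (0 : ℝ) ≤ if e ∈ Q K ∧ 2 * M < blockDegree 𝒦 Q A e then
          (if Disjoint (Q K) A then (1 : ℝ) else 0) else 0 := by
      intro e _; split_ifs <;> norm_num
    by_cases hd : Disjoint (Q K) A
    · by_cases hg : good K
      · have := Finset.sum_nonneg h0
        rw [if_pos hg]
        rw [if_pos hd] at this ⊢
        linarith
      · have : ∃ e ∈ Q K, 2 * M < blockDegree 𝒦 Q A e := by
          by_contra! hcon
          exact hg ⟨hd, hcon⟩
        obtain ⟨e, he, hlt⟩ := this
        have := Finset.single_le_sum h0 (hW K hK he)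
        rw [if_pos ⟨he, hlt⟩] at this
        rw [if_neg hg, zero_add]
        exact this
    · rw [if_neg hd]
      refine add_nonneg ?_ (by simp)
      split_ifs <;> norm_num
  rw [Finset.sum_add_distrib, Finset.sum_comm] at h2
  have h3 : ∀ e ∈ W, (∑ K ∈ 𝒦, if e ∈ Q K ∧ 2 * M < blockDegree 𝒦 Q A e then
          (if Disjoint (Q K) A then (1 : ℝ) else 0) else 0) =
      if 2 * M < blockDegree 𝒦 Q A e then blockDegree 𝒦 Q A e else 0 := by
    intro e _
    by_cases h : 2 * M < blockDegree 𝒦 Q A e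
    · simp only [h, and_true, if_true]
      rw [← Finset.sum_filter]; rfl
    · simp [h]
  rw [Finset.sum_congr rfl h3] at h2
  have h4 : (∑ K ∈ 𝒦, if good K then (1 : ℝ) else 0) ≤ 2 * M * fracPackingNumber 𝒦 Q A := by
    calc _ = 2 * M * ∑ K ∈ 𝒦, (if good K then 1 / (2 * M) else 0) := by
          rw [Finset.mul_sum]
          refine Finset.sum_congr rfl fun K _ => ?_
          split_ifs
          · field_simp
          · simp
      _ ≤ _ := by gcongr
  linarith

variable {p : ℝ} {U W : Finset ι} {h N : ℕ} {R : ℝ}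

theorem bernoulliExp_blockDegree (hW : ∀ K ∈ 𝒦, Q K ⊆ U) (hcard : ∀ K ∈ 𝒦, (Q K).card = h)
    {e : ι} (hN : (𝒦.filter fun K => e ∈ Q K).card = N) :
    bernoulliExp p U (fun A => blockDegree 𝒦 Q A e) = N * (1 - p) ^ h := by
  unfold blockDegree
  rw [bernoulliExp_sum, Finset.sum_congr rfl (g := fun _ => (1 - p) ^ h), Finset.sum_const, hN,
    nsmul_eq_mul]
  intro K hK
  have hK := (Finset.mem_filter.1 hK).1
  rw [bernoulliExp_disjoint (hW K hK), hcard K hK]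

/-- Two blocks through `e` both avoid the random set with probability `(1-p)^(2h - |Q K ∩ Q K'|)`.
Pulling out the value they would have if they met only in `e` leaves the weight `(1/(1-p))^(|Q K ∩ Q
K'| - 1)`, so `R` is the relative variance of the degree given that `e` is not chosen. -/
theorem bernoulliExp_blockDegree_sq (hp1 : p < 1) (hW : ∀ K ∈ 𝒦, Q K ⊆ U)
    (hcard : ∀ K ∈ 𝒦, (Q K).card = h) {e : ι} (hN : (𝒦.filter fun K => e ∈ Q K).card = N)
    (hR : ∀ K ∈ 𝒦, e ∈ Q K → ∑ K' ∈ 𝒦 with e ∈ Q K',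
      (1 / (1 - p)) ^ ((Q K ∩ Q K').card - 1) ≤ N * (1 + R)) (hh : 0 < h) :
    bernoulliExp p U (fun A => blockDegree 𝒦 Q A e ^ 2) ≤
      (1 - p) * (N * (1 - p) ^ (h - 1)) ^ 2 * (1 + R) := by
  have hq : 0 < 1 - p := by linarith
  have h1 : ∀ A, blockDegree 𝒦 Q A e ^ 2 = ∑ K ∈ 𝒦 with e ∈ Q K, ∑ K' ∈ 𝒦 with e ∈ Q K',
      if Disjoint (Q K ∪ Q K') A then (1 : ℝ) else 0 := by
    intro A
    rw [sq, blockDegree, Finset.sum_mul_sum]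
    refine Finset.sum_congr rfl fun K _ => Finset.sum_congr rfl fun K' _ => ?_
    by_cases a : Disjoint (Q K) A <;> by_cases b : Disjoint (Q K') A <;>
      simp [Finset.disjoint_union_left, a, b]
  simp_rw [h1]
  rw [bernoulliExp_sum]
  have h2 : ∀ K ∈ 𝒦.filter (fun K => e ∈ Q K), bernoulliExp p U (fun A => ∑ K' ∈ 𝒦 with e ∈ Q K',
      if Disjoint (Q K ∪ Q K') A then (1 : ℝ) else 0) ≤
      (1 - p) ^ (2 * h - 1) * (N * (1 + R)) := by
    intro K hK
    obtain ⟨hK, he⟩ := Finset.mem_filter.1 hK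
    rw [bernoulliExp_sum]
    refine le_trans (le_of_eq ?_) (mul_le_mul_of_nonneg_left (hR K hK he) (by positivity))
    rw [Finset.mul_sum]
    refine Finset.sum_congr rfl fun K' hK' => ?_
    obtain ⟨hK', he'⟩ := Finset.mem_filter.1 hK'
    rw [bernoulliExp_disjoint (Finset.union_subset (hW K hK) (hW K' hK'))]
    have c1 := Finset.card_union_add_card_inter (Q K) (Q K')
    rw [hcard K hK, hcard K' hK'] at c1
    have c2 : 0 < (Q K ∩ Q K').card :=
      Finset.card_pos.2 ⟨e, Finset.mem_inter.2 ⟨he, he'⟩⟩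
    have c3 : 2 * h - 1 = (Q K ∪ Q K').card + ((Q K ∩ Q K').card - 1) := by omega
    rw [c3, pow_add, mul_assoc, ← mul_pow, mul_one_div_cancel hq.ne', one_pow, mul_one]
  refine (Finset.sum_le_sum h2).trans (le_of_eq ?_)
  rw [Finset.sum_const, hN, nsmul_eq_mul, show 2 * h - 1 = 1 + (h - 1) * 2 by omega, pow_add,
    pow_mul]
  ring

open Classical in
/-- A lower bound for the expected fractional packing number by the second moment method. -/
theorem le_bernoulliExp_fracPackingNumber (hp0 : 0 ≤ p) (hp1 : p < 1) (hWU : W ⊆ U)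
    (hW : ∀ K ∈ 𝒦, Q K ⊆ W) (hcard : ∀ K ∈ 𝒦, (Q K).card = h)
    (hN : ∀ e ∈ W, (𝒦.filter fun K => e ∈ Q K).card = N)
    (hR : ∀ e ∈ W, ∀ K ∈ 𝒦, e ∈ Q K → ∑ K' ∈ 𝒦 with e ∈ Q K',
      (1 / (1 - p)) ^ ((Q K ∩ Q K').card - 1) ≤ N * (1 + R)) (hh : 0 < h) (hN0 : 0 < N)
    (hR4 : 4 * h * R ≤ 1) :
    W.card * (1 - p) / (4 * h) ≤ bernoulliExp p U (fracPackingNumber 𝒦 Q) := by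
  have hq : 0 < 1 - p := by linarith
  have hWU' : ∀ K ∈ 𝒦, Q K ⊆ U := fun K hK => (hW K hK).trans hWU
  have hQ : ∀ K ∈ 𝒦, (Q K).Nonempty := fun K hK => by
    rw [← Finset.card_pos, hcard K hK]; exact hh
  -- `M` is the expected degree of `e` conditioned on `e` not being chosen.
  set M : ℝ := N * (1 - p) ^ (h - 1) with hMdef
  have hN' : (0 : ℝ) < N := by exact_mod_cast hN0
  have hh' : (0 : ℝ) < h := by exact_mod_cast hh
  have hM : 0 < M := by positivity
  have hpow : (1 - p) ^ h = (1 - p) ^ (h - 1) * (1 - p) := by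
    rw [← pow_succ, Nat.sub_add_cancel hh]
  have hexc : ∀ e ∈ W, bernoulliExp p U (fun A =>
      if 2 * M < blockDegree 𝒦 Q A e then blockDegree 𝒦 Q A e else 0) ≤
      2 * M * (1 - p) * R := by
    intro e he
    -- If `X > 2M` then `X ≤ 2(X - M)` and `M ≤ X - M`, so `X ≤ (2/M)(X - M)²`. The indicator of `e
    -- ∉ A` multiplies `M²` because `X = 0` when `e ∈ A`; without it the constant term would not
    -- cancel to leave a multiple of `R`.
    calc _ ≤ bernoulliExp p U (fun A => 2 / M * (blockDegree 𝒦 Q A e ^ 2 -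
          2 * M * blockDegree 𝒦 Q A e + M ^ 2 * if Disjoint {e} A then 1 else 0)) := by
          refine bernoulliExp_mono hp0 hp1.le fun A _ => ?_
          by_cases heA : e ∈ A
          · rw [blockDegree_eq_zero heA]
            simp [heA]
          · simp only [Finset.disjoint_singleton_left, heA, not_false_eq_true, if_true]
            set X := blockDegree 𝒦 Q A e
            rw [show X ^ 2 - 2 * M * X + M ^ 2 * 1 = (X - M) ^ 2 by ring, div_mul_eq_mul_div]
            split_ifs with hX
            · rw [le_div_iff₀ hM]
              nlinarith [mul_pos hM hM]
            · positivity
      _ = 2 / M * (bernoulliExp p U (fun A => blockDegree 𝒦 Q A e ^ 2) -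
          2 * M * (N * (1 - p) ^ h) + M ^ 2 * (1 - p)) := by
          rw [bernoulliExp_const_mul, bernoulliExp_add, bernoulliExp_sub, bernoulliExp_const_mul,
            bernoulliExp_const_mul, bernoulliExp_blockDegree hWU' hcard (hN e he),
            bernoulliExp_disjoint (Finset.singleton_subset_iff.2 (hWU he))]
          simp
      _ ≤ 2 / M * ((1 - p) * M ^ 2 * (1 + R) - 2 * M * (N * (1 - p) ^ h) + M ^ 2 * (1 - p)) := by
          gcongr
          exact bernoulliExp_blockDegree_sq hp1 hWU' hcard (hN e he) (hR e he) hh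
      _ = _ := by
          rw [hpow, ← mul_assoc (N : ℝ), ← hMdef]
          field_simp
          ring
  -- Double counting of incidences between blocks and elements of `W`.
  have hdc : (𝒦.card : ℝ) * h = W.card * N := by
    have : 𝒦.card * h = W.card * N := by
      refine Finset.card_mul_eq_card_mul (fun K e => e ∈ Q K) (fun K hK => ?_) fun e he => ?_
      · rw [Finset.bipartiteAbove, Finset.filter_mem_eq_inter,
          Finset.inter_eq_right.2 (hW K hK), hcard K hK]
      · exact hN e he
    exact_mod_cast this
  have hmain : (𝒦.card : ℝ) * (1 - p) ^ h - W.card * (2 * M * (1 - p) * R) ≤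
      2 * M * bernoulliExp p U (fracPackingNumber 𝒦 Q) := by
    calc _ ≤ bernoulliExp p U (fun A => (∑ K ∈ 𝒦, if Disjoint (Q K) A then (1 : ℝ) else 0) -
          ∑ e ∈ W, (if 2 * M < blockDegree 𝒦 Q A e then blockDegree 𝒦 Q A e else 0)) := by
          rw [bernoulliExp_sub, bernoulliExp_sum, bernoulliExp_sum]
          refine sub_le_sub (le_of_eq ?_) ?_
          · rw [Finset.sum_congr rfl (g := fun _ => (1 - p) ^ h), Finset.sum_const, nsmul_eq_mul]
            intro K hK
            rw [bernoulliExp_disjoint (hWU' K hK), hcard K hK]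
          · rw [← nsmul_eq_mul, ← Finset.sum_const]
            exact Finset.sum_le_sum hexc
      _ ≤ bernoulliExp p U (fun A => 2 * M * fracPackingNumber 𝒦 Q A) :=
          bernoulliExp_mono hp0 hp1.le fun A _ => sub_le_two_mul_fracPackingNumber hM hQ hW
      _ = _ := bernoulliExp_const_mul _
  have hX : (𝒦.card : ℝ) * (1 - p) ^ h = W.card * (1 - p) * M / h := by
    rw [eq_div_iff hh'.ne', hpow, hMdef]
    linear_combination (1 - p) ^ (h - 1) * (1 - p) * hdc
  rw [hX] at hmain
  refine le_of_mul_le_mul_left (le_trans ?_ hmain) (by positivity : 0 < 2 * M)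
  have e1 : 2 * M * (W.card * (1 - p) / (4 * h)) =
      W.card * (1 - p) * M / h - W.card * (1 - p) * M * (2 * (1 / (4 * h))) := by
    field_simp; ring
  -- The hypothesis on `R` makes the loss from high-degree elements at most half of the expected
  -- number of surviving blocks.
  have e2 : R ≤ 1 / (4 * h) := by
    rw [le_div_iff₀ (by positivity)]; linarith
  have e3 : 0 ≤ W.card * (1 - p) * M := by positivity
  rw [e1]
  nlinarith [mul_le_mul_of_nonneg_left e2 e3]

end FracPacking

/-! ### Independent `k`-sets as blocks of pairs -/

section Pairs

variable {V : Type*} [DecidableEq V]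

/-- The pairs of distinct vertices in `K`. -/
def pairs (K : Finset V) : Finset (Sym2 V) := K.sym2.filter fun e => ¬ e.IsDiag

theorem mk_mem_pairs {K : Finset V} {u v : V} : s(u, v) ∈ pairs K ↔ (u ∈ K ∧ v ∈ K) ∧ u ≠ v := by
  simp [pairs]

theorem card_pairs (K : Finset V) : (pairs K).card = K.card.choose 2 := by
  rw [← Sym2.card_image_offDiag]
  congr 1
  ext e
  induction e using Sym2.ind with
  | _ u v =>
    rw [mk_mem_pairs, Finset.mem_image]
    constructor
    · rintro ⟨⟨hu, hv⟩, h⟩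
      exact ⟨(u, v), Finset.mem_offDiag.2 ⟨hu, hv, h⟩, rfl⟩
    · rintro ⟨⟨a, b⟩, hab, h⟩
      obtain ⟨ha, hb, hne⟩ := Finset.mem_offDiag.1 hab
      rcases Sym2.eq_iff.1 h with ⟨h1, h2⟩ | ⟨h1, h2⟩ <;> simp only at h1 h2 ha hb hne <;> subst h1 <;> subst h2
      · exact ⟨⟨ha, hb⟩, hne⟩
      · exact ⟨⟨hb, ha⟩, hne.symm⟩

theorem pairs_inter (K L : Finset V) : pairs K ∩ pairs L = pairs (K ∩ L) := by
  ext e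
  induction e using Sym2.ind with
  | _ u v => simp only [Finset.mem_inter, mk_mem_pairs]; tauto

theorem pairs_mono {K L : Finset V} (h : K ⊆ L) : pairs K ⊆ pairs L := by
  intro e
  induction e using Sym2.ind with
  | _ u v => simp only [mk_mem_pairs]; exact fun h' => ⟨⟨h h'.1.1, h h'.1.2⟩, h'.2⟩

theorem mk_mem_pairs_iff_subset {K : Finset V} {u v : V} (huv : u ≠ v) :
    s(u, v) ∈ pairs K ↔ {u, v} ⊆ K := by
  simp [mk_mem_pairs, huv, Finset.insert_subset_iff]

theorem card_powersetCard_filter_superset {S I : Finset V} (hI : I ⊆ S) {k : ℕ}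
    (hk : I.card ≤ k) :
    ((S.powersetCard k).filter fun K => I ⊆ K).card = (S.card - I.card).choose (k - I.card) := by
  rw [← Finset.card_sdiff_of_subset hI, ← Finset.card_powersetCard]
  refine Finset.card_bij' (fun K _ => K \ I) (fun L _ => L ∪ I) ?_ ?_ ?_ ?_
  · intro K hK
    simp only [Finset.mem_filter, Finset.mem_powersetCard] at hK ⊢
    exact ⟨Finset.sdiff_subset_sdiff hK.1.1 le_rfl,
      by rw [Finset.card_sdiff_of_subset hK.2, hK.1.2]⟩
  · intro L hL
    simp only [Finset.mem_filter, Finset.mem_powersetCard] at hL ⊢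
    have hd : Disjoint L I := (Finset.subset_sdiff.1 hL.1).2
    refine ⟨⟨Finset.union_subset (hL.1.trans Finset.sdiff_subset) hI, ?_⟩,
      Finset.subset_union_right⟩
    rw [Finset.card_union_of_disjoint hd, hL.2, Nat.sub_add_cancel hk]
  · intro K hK
    exact Finset.sdiff_union_of_subset (Finset.mem_filter.1 hK).2
  · intro L hL
    have hd : Disjoint L I := (Finset.subset_sdiff.1 (Finset.mem_powersetCard.1 hL).1).2
    rw [Finset.union_sdiff_right, Finset.sdiff_eq_self_of_disjoint hd]

theorem card_powersetCard_filter_mem_pairs {S : Finset V} {e : Sym2 V} (he : e ∈ pairs S) {k : ℕ}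
    (hk : 2 ≤ k) :
    ((S.powersetCard k).filter fun K => e ∈ pairs K).card = (S.card - 2).choose (k - 2) := by
  induction e using Sym2.ind with
  | _ u v =>
    have huv := (mk_mem_pairs.1 he).2
    simp_rw [mk_mem_pairs_iff_subset huv] at he ⊢
    have := card_powersetCard_filter_superset he (k := k) (by rwa [Finset.card_pair huv])
    rwa [Finset.card_pair huv] at this

/-- Each further prescribed vertex multiplies the count by `(k-m-i)/(s-m-i)`, which is at most `k/s`
since `k ≤ s`. -/
theorem choose_sub_sub_le {s k i m : ℕ} (hks : k ≤ s) (him : m + i ≤ k) (hm : 0 < m) :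
    ((s - m - i).choose (k - m - i) : ℝ) ≤ (s - m).choose (k - m) * ((k : ℝ) / s) ^ i := by
  induction i with
  | zero => simp
  | succ i ih =>
    refine le_trans ?_ (le_of_le_of_eq (mul_le_mul_of_nonneg_right (ih (by omega))
      (by positivity : (0 : ℝ) ≤ (k : ℝ) / s)) (by rw [pow_succ, mul_assoc]))
    have h1 := Nat.add_one_mul_choose_eq (s - m - (i + 1)) (k - m - (i + 1))
    rw [show s - m - (i + 1) + 1 = s - m - i by omega,
      show k - m - (i + 1) + 1 = k - m - i by omega] at h1
    have hs : (0 : ℝ) < s := by exact_mod_cast (by omega : 0 < s)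
    have ht : (0 : ℝ) < (s - m - i : ℕ) := by exact_mod_cast (by omega : 0 < s - m - i)
    have h2 : ((s - m - i : ℕ) : ℝ) * (s - m - (i + 1)).choose (k - m - (i + 1)) =
        (s - m - i).choose (k - m - i) * (k - m - i : ℕ) := by exact_mod_cast h1
    have h3 : ((k - m - i : ℕ) : ℝ) * s ≤ k * (s - m - i : ℕ) := by
      have e1 : ((k - m - i : ℕ) : ℝ) = k - (m + i : ℕ) := by
        rw [Nat.sub_sub, Nat.cast_sub (by omega)]
      have e2 : ((s - m - i : ℕ) : ℝ) = s - (m + i : ℕ) := by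
        rw [Nat.sub_sub, Nat.cast_sub (by omega)]
      rw [e1, e2]
      have : (k : ℝ) ≤ s := by exact_mod_cast hks
      nlinarith [Nat.cast_nonneg (α := ℝ) (m + i)]
    rw [← mul_div_assoc, le_div_iff₀ hs]
    refine le_of_mul_le_mul_left ?_ ht
    rw [← mul_assoc, h2]
    calc _ = ((s - m - i).choose (k - m - i) : ℝ) * ((k - m - i : ℕ) * s) := by ring
      _ ≤ ((s - m - i).choose (k - m - i) : ℝ) * (k * (s - m - i : ℕ)) := by gcongr
      _ = _ := by ring

/-- The bound for the relative variance of the number of independent `k`-sets through a pair. -/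
noncomputable def overlapBound (β : ℝ) (s k : ℕ) : ℝ :=
  ∑ i ∈ Finset.Icc 1 k, (k.choose i : ℝ) * ((k : ℝ) / s) ^ i * (β ^ ((i + 2).choose 2 - 1) - 1)

/-- The second moment sum is organised by the part `I` of `K ∩ K'` outside `e`; having `i` such
vertices creates `C(i+2,2) - 1` common pairs besides `e`. Counting the `K'` that contain `I`,
instead of those meeting `K` in exactly `I ∪ e`, only increases the sum. -/
theorem sum_pow_card_inter_le {β : ℝ} (hβ : 1 ≤ β) {S : Finset V} {k : ℕ} (hkS : k ≤ S.card)
    {K : Finset V} (hK : K ∈ S.powersetCard k) {e : Sym2 V} (he : e ∈ pairs K) :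
    ∑ K' ∈ S.powersetCard k with e ∈ pairs K', β ^ ((pairs K ∩ pairs K').card - 1) ≤
      ((S.card - 2).choose (k - 2) : ℕ) * (1 + overlapBound β S.card k) := by
  obtain ⟨hKS, hKk⟩ := Finset.mem_powersetCard.1 hK
  set g : ℕ → ℝ := fun i => β ^ ((i + 2).choose 2 - 1) - 1 with hg
  have hg0 : ∀ i, 0 ≤ g i := fun i => sub_nonneg.2 (one_le_pow₀ hβ)
  set F := (S.powersetCard k).filter fun K' => e ∈ pairs K' with hF
  induction e using Sym2.ind with
  | _ u v =>
  have huv := (mk_mem_pairs.1 he).2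
  have huvK := (mk_mem_pairs_iff_subset huv).1 he
  have hk2 : 2 ≤ k := by
    rw [← hKk, ← Finset.card_pair huv]; exact Finset.card_le_card huvK
  have hFc : F.card = (S.card - 2).choose (k - 2) :=
    card_powersetCard_filter_mem_pairs (pairs_mono hKS he) hk2
  set D := K \ {u, v} with hD
  have hDc : D.card = k - 2 := by
    rw [hD, Finset.card_sdiff_of_subset huvK, hKk, Finset.card_pair huv]
  have h1 : ∀ K' ∈ F, β ^ ((pairs K ∩ pairs K').card - 1) ≤ 1 + ∑ i ∈ Finset.Icc 1 k,
      ∑ I ∈ D.powersetCard i, if I ∪ {u, v} ⊆ K' then g i else 0 := by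
    intro K' hK'
    have hK'e := (mk_mem_pairs_iff_subset huv).1 (Finset.mem_filter.1 hK').2
    have hsub : {u, v} ⊆ K ∩ K' := Finset.subset_inter huvK hK'e
    rw [pairs_inter, card_pairs]
    set J := (K ∩ K') \ {u, v} with hJ
    have hJc : (K ∩ K').card = J.card + 2 := by
      have := Finset.card_sdiff_add_card_eq_card hsub
      rw [Finset.card_pair huv, ← hJ] at this
      exact this.symm
    have hnn : ∀ i ∈ Finset.Icc 1 k, 0 ≤ ∑ I ∈ D.powersetCard i,
        if I ∪ {u, v} ⊆ K' then g i else 0 := fun i _ => Finset.sum_nonneg fun I _ => by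
      split_ifs
      exacts [hg0 i, le_rfl]
    rw [hJc]
    by_cases hJ0 : J.card = 0
    · rw [hJ0]
      have := Finset.sum_nonneg hnn
      simpa using this
    · have hJk : J.card ≤ k := by
        rw [← hKk]
        exact Finset.card_le_card (Finset.sdiff_subset.trans Finset.inter_subset_left)
      -- Of all the terms only the one with `I` equal to the actual extra intersection `J` is
      -- needed.
      have a1 := Finset.single_le_sum hnn (Finset.mem_Icc.2 ⟨Nat.one_le_iff_ne_zero.2 hJ0, hJk⟩)
      have hJD : J ∈ D.powersetCard J.card := Finset.mem_powersetCard.2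
        ⟨Finset.sdiff_subset_sdiff Finset.inter_subset_left le_rfl, rfl⟩
      have a2 := Finset.single_le_sum (f := fun I => if I ∪ {u, v} ⊆ K' then g J.card else 0)
        (fun I _ => by split_ifs; exacts [hg0 _, le_rfl]) hJD
      rw [if_pos] at a2
      · have : β ^ ((J.card + 2).choose 2 - 1) = 1 + g J.card := by simp [hg]
        rw [this]
        linarith
      · exact Finset.union_subset (Finset.sdiff_subset.trans Finset.inter_subset_right) hK'e
  refine (Finset.sum_le_sum h1).trans ?_
  rw [Finset.sum_add_distrib, Finset.sum_const, hFc, nsmul_eq_mul, mul_one, mul_add, mul_one]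
  refine add_le_add_right ?_ _
  rw [Finset.sum_comm, overlapBound, Finset.mul_sum]
  refine Finset.sum_le_sum fun i hi => ?_
  rw [Finset.sum_comm]
  have hi1 := (Finset.mem_Icc.1 hi).1
  have hcount : ∀ I ∈ D.powersetCard i, ∑ K' ∈ F, (if I ∪ {u, v} ⊆ K' then g i else 0) ≤
      (S.card - 2).choose (k - 2) * ((k : ℝ) / S.card) ^ i * g i := by
    intro I hI
    obtain ⟨hID, hIc⟩ := Finset.mem_powersetCard.1 hI
    have hdis : Disjoint I {u, v} := (Finset.subset_sdiff.1 hID).2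
    have hc : (I ∪ {u, v}).card = i + 2 := by
      rw [Finset.card_union_of_disjoint hdis, hIc, Finset.card_pair huv]
    have hik : i + 2 ≤ k := by
      have := Finset.card_le_card hID
      omega
    have hsubS : I ∪ {u, v} ⊆ S :=
      (Finset.union_subset (hID.trans Finset.sdiff_subset) huvK).trans hKS
    rw [← Finset.sum_filter, Finset.sum_const, nsmul_eq_mul]
    refine mul_le_mul_of_nonneg_right ?_ (hg0 i)
    have h2 : (F.filter fun K' => I ∪ {u, v} ⊆ K').card ≤
        (S.card - 2 - i).choose (k - 2 - i) := by
      have := card_powersetCard_filter_superset hsubS (k := k) (by omega)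
      rw [hc, show S.card - (i + 2) = S.card - 2 - i by omega,
        show k - (i + 2) = k - 2 - i by omega] at this
      rw [← this]
      exact Finset.card_le_card (Finset.filter_subset_filter _ (Finset.filter_subset _ _))
    refine le_trans (by exact_mod_cast h2) (choose_sub_sub_le hkS (by omega) (by norm_num))
  refine (Finset.sum_le_card_nsmul _ _ _ hcount).trans ?_
  rw [Finset.card_powersetCard, hDc, nsmul_eq_mul]
  have h3 : ((k - 2).choose i : ℝ) ≤ k.choose i := by
    exact_mod_cast Nat.choose_le_choose i (Nat.sub_le k 2)
  calc _ ≤ (k.choose i : ℝ) * ((S.card - 2).choose (k - 2) * ((k : ℝ) / S.card) ^ i * g i) := by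
        refine mul_le_mul_of_nonneg_right h3 ?_
        have := hg0 i
        positivity
    _ = _ := by rw [hg]; ring

/-- The expected fractional packing number of the independent `k`-sets inside `S`. -/
theorem le_bernoulliExp_fracPackingNumber_pairs {p : ℝ} (hp0 : 0 ≤ p) (hp : p ≤ 1 / 2)
    {U : Finset (Sym2 V)} {S : Finset V} (hSU : pairs S ⊆ U) {k : ℕ} (hk : 2 ≤ k)
    (hkS : k ≤ S.card) (hR : 2 * (k : ℝ) ^ 2 * overlapBound (1 / (1 - p)) S.card k ≤ 1) :
    (S.card : ℝ) ^ 2 / (8 * (k : ℝ) ^ 2) ≤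
      bernoulliExp p U (fracPackingNumber (S.powersetCard k) pairs) := by
  have hq : 0 < 1 - p := by linarith
  have hβ : 1 ≤ 1 / (1 - p) := by rw [le_div_iff₀ hq]; linarith
  have hk' : (2 : ℝ) ≤ k := by exact_mod_cast hk
  have hkS' : (k : ℝ) ≤ S.card := by exact_mod_cast hkS
  have hch : ∀ m : ℕ, (m.choose 2 : ℝ) = m * (m - 1) / 2 := fun m => Nat.cast_choose_two ℝ m
  have hR0 : 0 ≤ overlapBound (1 / (1 - p)) S.card k :=
    Finset.sum_nonneg fun i _ => mul_nonneg (by positivity) (sub_nonneg.2 (one_le_pow₀ hβ))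
  refine le_trans ?_ (le_bernoulliExp_fracPackingNumber (W := pairs S) (h := k.choose 2)
    (N := (S.card - 2).choose (k - 2)) (R := overlapBound (1 / (1 - p)) S.card k)
    hp0 (by linarith) hSU ?_ ?_ ?_ ?_ (Nat.choose_pos hk) (Nat.choose_pos (by omega)) ?_)
  · rw [card_pairs, hch, hch]
    have h1 : 0 < (k : ℝ) * (k - 1) := mul_pos (by linarith) (by linarith)
    rw [div_le_div_iff₀ (by positivity) (by linarith)]
    -- Equivalent to `(k-1)/k ≤ (s-1)/s`, which compares `C(s,2)/C(k,2)` with `s²/k²`; the factor `1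
    -- - p ≥ 1/2` turns the 4 into 8.
    have h2 : (S.card : ℝ) * (k - 1) ≤ k * (S.card - 1) := by linarith
    have h3 : (0 : ℝ) ≤ S.card * k := by positivity
    have h4 : 0 ≤ (S.card : ℝ) * (S.card - 1) * (1 / 2 - p) * k ^ 2 :=
      mul_nonneg (mul_nonneg (mul_nonneg (by positivity) (by linarith)) (by linarith))
        (by positivity)
    nlinarith [mul_le_mul_of_nonneg_left h2 h3]
  · intro K hK
    exact pairs_mono (Finset.mem_powersetCard.1 hK).1
  · intro K hK
    rw [card_pairs, (Finset.mem_powersetCard.1 hK).2]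
  · intro e he
    rw [← card_powersetCard_filter_mem_pairs he hk]
  · intro e _ K hK he
    refine le_trans (le_of_eq ?_) (sum_pow_card_inter_le hβ hkS hK he)
    congr!
  · rw [hch]
    nlinarith

end Pairs

/-! ### Colouring by extraction, degeneracy and Caro–Wei -/

section Coloring

variable {V : Type*} {G H : SimpleGraph V} {S T : Finset V}

/-- The set `S` can be properly coloured with `m` colours in `G`. -/
def ColorableOn (G : SimpleGraph V) (S : Finset V) (m : ℕ) : Prop :=
  ∃ c : V → ℕ, (∀ v ∈ S, c v < m) ∧ ∀ u ∈ S, ∀ v ∈ S, G.Adj u v → c u ≠ c v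

theorem colorableOn_empty (m : ℕ) : ColorableOn G ∅ m :=
  ⟨fun _ => 0, by simp, by simp⟩

open Classical in
/-- The number of neighbours of `v` inside `T`. -/
noncomputable def degreeIn (G : SimpleGraph V) (T : Finset V) (v : V) : ℕ :=
  (T.filter fun u => G.Adj v u).card

open Classical in
theorem degreeIn_mono (hST : S ⊆ T) (v : V) : degreeIn G S v ≤ degreeIn G T v :=
  Finset.card_le_card (Finset.filter_subset_filter _ hST)

theorem degreeIn_lt_card {v : V} (hv : v ∈ T) : degreeIn G T v < T.card := by
  classical
  refine Finset.card_lt_card ⟨Finset.filter_subset _ _, fun h => ?_⟩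
  exact G.loopless.irrefl v (Finset.mem_filter.1 (h hv)).2

variable [DecidableEq V]

theorem ColorableOn.succ_of_sdiff {I : Finset V} {m : ℕ} (h : ColorableOn G (S \ I) m)
    (hI : ∀ u ∈ I, ∀ v ∈ I, ¬ G.Adj u v) : ColorableOn G S (m + 1) := by
  obtain ⟨c, h1, h2⟩ := h
  refine ⟨fun v => if v ∈ I then m else c v, fun v hv => ?_, fun u hu v hv huv => ?_⟩
  · dsimp only
    split_ifs with hvI
    · exact Nat.lt_succ_self m
    · exact (h1 v (Finset.mem_sdiff.2 ⟨hv, hvI⟩)).trans (Nat.lt_succ_self m)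
  · dsimp only
    split_ifs with a b b
    · exact absurd huv (hI u a v b)
    · exact (h1 v (Finset.mem_sdiff.2 ⟨hv, b⟩)).ne'
    · exact (h1 u (Finset.mem_sdiff.2 ⟨hu, a⟩)).ne
    · exact h2 u (Finset.mem_sdiff.2 ⟨hu, a⟩) v (Finset.mem_sdiff.2 ⟨hv, b⟩) huv

open Classical in
/-- The number of edges inside `T`. -/
noncomputable def edgesIn (G : SimpleGraph V) (T : Finset V) : ℕ :=
  ((pairs T).filter fun e => e ∈ G.edgeSet).card

-- Greedy colouring: colour everything but a vertex with fewer than `m` neighbours, then give it a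
-- colour none of them uses.
open Classical in
theorem colorableOn_of_degenerate {m : ℕ}
    (h : ∀ T ⊆ S, T.Nonempty → ∃ v ∈ T, degreeIn G T v < m) : ColorableOn G S m := by
  induction S using Finset.strongInduction with
  | H S ih =>
    rcases S.eq_empty_or_nonempty with rfl | hS
    · exact colorableOn_empty m
    obtain ⟨v, hv, hdeg⟩ := h S le_rfl hS
    obtain ⟨c, h1, h2⟩ := ih (S.erase v) (Finset.erase_ssubset hv)
      fun T hT => h T (hT.trans (Finset.erase_subset _ _))
    obtain ⟨a, ha, hna⟩ : ∃ a ∈ Finset.range m, a ∉ (S.filter fun u => G.Adj v u).image c := by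
      refine Finset.exists_mem_notMem_of_card_lt_card ?_
      rw [Finset.card_range]
      exact Finset.card_image_le.trans_lt hdeg
    have hne : ∀ u ∈ S, G.Adj v u → a ≠ c u := fun u hu huv h' =>
      hna (h' ▸ Finset.mem_image_of_mem c (Finset.mem_filter.2 ⟨hu, huv⟩))
    refine ⟨fun u => if u = v then a else c u, fun u hu => ?_, fun u hu w hw huw => ?_⟩
    · dsimp only
      split_ifs with huv
      · exact Finset.mem_range.1 ha
      · exact h1 u (Finset.mem_erase.2 ⟨huv, hu⟩)
    · dsimp only
      split_ifs with e1 e2 e2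
      · exact absurd (e1.trans e2.symm) huw.ne
      · exact hne w hw (e1 ▸ huw)
      · exact (hne u hu (e2 ▸ huw.symm)).symm
      · exact h2 u (Finset.mem_erase.2 ⟨e1, hu⟩) w (Finset.mem_erase.2 ⟨e2, hw⟩) huw

open Classical in
theorem sum_degreeIn (G : SimpleGraph V) (T : Finset V) :
    ∑ v ∈ T, degreeIn G T v = 2 * edgesIn G T := by
  induction T using Finset.induction_on with
  | empty => simp [edgesIn, pairs]
  | insert a T ha ih =>
    have h1 : ∀ v ∈ T, degreeIn G (insert a T) v = degreeIn G T v + if G.Adj a v then 1 else 0 := by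
      intro v _
      rw [degreeIn, Finset.filter_insert]
      split_ifs with h h' h'
      · rw [Finset.card_insert_of_notMem fun h' => ha (Finset.mem_filter.1 h').1]; rfl
      · exact absurd h.symm h'
      · exact absurd h'.symm h
      · rfl
    have h2 : degreeIn G (insert a T) a = degreeIn G T a := by
      rw [degreeIn, Finset.filter_insert, if_neg (G.loopless.irrefl a)]; rfl
    have h3 : edgesIn G (insert a T) = edgesIn G T + degreeIn G T a := by
      have : (pairs (insert a T)).filter (fun e => e ∈ G.edgeSet) =
          (pairs T).filter (fun e => e ∈ G.edgeSet) ∪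
            (T.filter fun u => G.Adj a u).image fun u => s(a, u) := by
        ext e
        induction e using Sym2.ind with
        | _ x y =>
          simp only [Finset.mem_union, Finset.mem_filter, mk_mem_pairs, Finset.mem_insert,
            Finset.mem_image, SimpleGraph.mem_edgeSet]
          constructor
          · rintro ⟨⟨⟨hx, hy⟩, hne⟩, hadj⟩
            rcases hx with rfl | hx <;> rcases hy with rfl | hy
            · exact absurd rfl hne
            · exact Or.inr ⟨y, ⟨hy, hadj⟩, rfl⟩
            · exact Or.inr ⟨x, ⟨hx, hadj.symm⟩, Sym2.eq_swap⟩
            · exact Or.inl ⟨⟨⟨hx, hy⟩, hne⟩, hadj⟩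
          · rintro (⟨⟨⟨hx, hy⟩, hne⟩, hadj⟩ | ⟨u, ⟨hu, hadj⟩, he⟩)
            · exact ⟨⟨⟨Or.inr hx, Or.inr hy⟩, hne⟩, hadj⟩
            · rcases Sym2.eq_iff.1 he with ⟨rfl, rfl⟩ | ⟨rfl, rfl⟩
              · exact ⟨⟨⟨Or.inl rfl, Or.inr hu⟩, hadj.ne⟩, hadj⟩
              · exact ⟨⟨⟨Or.inr hu, Or.inl rfl⟩, hadj.ne.symm⟩, hadj.symm⟩
      rw [edgesIn, this, Finset.card_union_of_disjoint, Finset.card_image_of_injective]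
      · rfl
      · exact fun u v huv => Sym2.congr_right.1 huv
      · rw [Finset.disjoint_right]
        intro e he he'
        obtain ⟨u, _, rfl⟩ := Finset.mem_image.1 he
        exact ha (mk_mem_pairs.1 (Finset.mem_filter.1 he').1).1.1
    rw [Finset.sum_insert ha, Finset.sum_congr rfl h1, Finset.sum_add_distrib, ih, h2, h3,
      ← Finset.card_filter]
    change degreeIn G T a + (2 * edgesIn G T + degreeIn G T a) = _
    ring

theorem exists_degreeIn_mul_card_le (hT : T.Nonempty) :
    ∃ v ∈ T, degreeIn G T v * T.card ≤ 2 * edgesIn G T := by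
  obtain ⟨v, hv, hmin⟩ := Finset.exists_min_image T (degreeIn G T) hT
  refine ⟨v, hv, ?_⟩
  rw [← sum_degreeIn, mul_comm, ← smul_eq_mul]
  exact Finset.card_nsmul_le_sum _ _ _ hmin

theorem edgesIn_sup_le (G H : SimpleGraph V) (T : Finset V) :
    edgesIn (G ⊔ H) T ≤ edgesIn G T + edgesIn H T := by
  classical
  unfold edgesIn
  refine le_trans (Finset.card_le_card ?_) (Finset.card_union_le _ _)
  intro e he
  simp only [Finset.mem_filter, SimpleGraph.edgeSet_sup] at he
  obtain ⟨h1, h2⟩ := he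
  rcases h2 with h2 | h2
  · exact Finset.mem_union_left _ (Finset.mem_filter.2 ⟨h1, h2⟩)
  · exact Finset.mem_union_right _ (Finset.mem_filter.2 ⟨h1, h2⟩)

open Classical in
/-- The Caro–Wei bound. -/
theorem caro_wei (H : SimpleGraph V) (K : Finset V) : ∃ I ⊆ K,
    (∀ u ∈ I, ∀ v ∈ I, ¬ H.Adj u v) ∧
      ∑ v ∈ K, (1 : ℝ) / (degreeIn H K v + 1) ≤ I.card := by
  induction K using Finset.strongInduction with
  | H K ih =>
    rcases K.eq_empty_or_nonempty with rfl | hK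
    · exact ⟨∅, by simp, by simp, by simp⟩
    obtain ⟨v, hv, hmin⟩ := Finset.exists_min_image K (degreeIn H K) hK
    -- Deleting the closed neighbourhood of a vertex of minimum degree removes `deg + 1` summands,
    -- each at most `1/(deg + 1)`, so the sum drops by at most 1 while one vertex is gained; the
    -- degrees of the remaining vertices only decrease.
    set N := insert v (K.filter fun u => H.Adj v u) with hN
    have hNK : N ⊆ K := Finset.insert_subset hv (Finset.filter_subset _ _)
    have hNc : N.card = degreeIn H K v + 1 := by
      rw [hN, Finset.card_insert_of_notMem]
      · rfl
      · exact fun h => H.loopless.irrefl v (Finset.mem_filter.1 h).2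
    obtain ⟨I, hIK, hI, hsum⟩ := ih (K \ N) (Finset.sdiff_ssubset hNK ⟨v, Finset.mem_insert_self _ _⟩)
    have hvI : ∀ u ∈ I, u ∈ K ∧ u ≠ v ∧ ¬ H.Adj v u := by
      intro u hu
      obtain ⟨h1, h2⟩ := Finset.mem_sdiff.1 (hIK hu)
      rw [hN, Finset.mem_insert, Finset.mem_filter] at h2
      tauto
    refine ⟨insert v I, Finset.insert_subset hv (hIK.trans Finset.sdiff_subset), ?_, ?_⟩
    · intro a ha b hb hab
      rcases Finset.mem_insert.1 ha with ha' | ha <;> rcases Finset.mem_insert.1 hb with hb' | hb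
      · exact hab.ne (ha'.trans hb'.symm)
      · exact (hvI b hb).2.2 (ha' ▸ hab)
      · exact (hvI a ha).2.2 (hb' ▸ hab.symm)
      · exact hI a ha b hb hab
    · rw [Finset.card_insert_of_notMem fun h => (hvI v h).2.1 rfl, ← Finset.sum_sdiff hNK]
      push_cast
      refine add_le_add (le_trans (Finset.sum_le_sum fun u _ => ?_) hsum) ?_
      · have : degreeIn H (K \ N) u ≤ degreeIn H K u := degreeIn_mono Finset.sdiff_subset u
        gcongr
      · have h1 : ∀ u ∈ N, (1 : ℝ) / (degreeIn H K u + 1) ≤ 1 / (degreeIn H K v + 1) := by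
          intro u hu
          have := hmin u (hNK hu)
          gcongr
        refine (Finset.sum_le_card_nsmul _ _ _ h1).trans ?_
        rw [hNc, nsmul_eq_mul]
        push_cast
        rw [mul_one_div_cancel (by positivity)]

/-- Caro–Wei combined with Cauchy–Schwarz, as `∑ (deg + 1) = |K| + 2e(K)`. This is Turán's bound in
terms of the number of edges. -/
theorem exists_indep_card_mul_ge (H : SimpleGraph V) (K : Finset V) : ∃ I ⊆ K,
    (∀ u ∈ I, ∀ v ∈ I, ¬ H.Adj u v) ∧
      (K.card : ℝ) ^ 2 ≤ I.card * (K.card + 2 * edgesIn H K) := by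
  obtain ⟨I, hIK, hI, hsum⟩ := caro_wei H K
  refine ⟨I, hIK, hI, ?_⟩
  have h1 : ((K.card : ℝ) + 2 * edgesIn H K) = ∑ v ∈ K, ((degreeIn H K v : ℝ) + 1) := by
    rw [Finset.sum_add_distrib, Finset.sum_const, nsmul_one, add_comm]
    congr 1
    exact_mod_cast (sum_degreeIn H K).symm
  have h2 := Finset.sum_sq_le_sum_mul_sum_of_sq_le_mul K (r := fun _ => (1 : ℝ))
    (f := fun v => (1 : ℝ) / (degreeIn H K v + 1)) (g := fun v => (degreeIn H K v : ℝ) + 1)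
    (fun v _ => by positivity) (fun v _ => by positivity)
    (fun v _ => by rw [one_pow, one_div_mul_cancel (by positivity)])
  rw [Finset.sum_const, nsmul_one] at h2
  rw [h1]
  exact h2.trans (mul_le_mul_of_nonneg_right hsum
    (Finset.sum_nonneg fun v _ => by positivity))

/-- Repeatedly extracting independent sets whose size is controlled by `D`. -/
theorem exists_colorableOn_of_extraction {s₀ k : ℝ} {Q : ℕ} {D φ : ℝ → ℝ} (hk : 0 < k)
    (hQ : ∀ S : Finset V, (S.card : ℝ) ≤ s₀ → ColorableOn G S Q)
    (hI : ∀ S : Finset V, s₀ < S.card → ∃ I ⊆ S, (∀ u ∈ I, ∀ v ∈ I, ¬ G.Adj u v) ∧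
      k ≤ I.card * (1 + D S.card))
    (hD : ∀ s, s₀ ≤ s → 0 ≤ D s)
    (hφ : ∀ s' s, s₀ ≤ s' → s' ≤ s → (s - s') * D s ≤ φ s - φ s')
    (S : Finset V) (hS : s₀ < S.card) :
    ∃ m : ℕ, ColorableOn G S m ∧
      (m : ℝ) ≤ Q + 1 + (S.card - s₀ + (φ S.card - φ s₀)) / k := by
  induction S using Finset.strongInduction with
  | H S ih =>
    obtain ⟨I, hIS, hind, hIk⟩ := hI S hS
    have hIc : 0 < I.card := by
      rcases Nat.eq_zero_or_pos I.card with h | h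
      · rw [h] at hIk; simp at hIk; linarith
      · exact h
    have hc : ((S \ I).card : ℝ) = S.card - I.card := by
      rw [Finset.card_sdiff_of_subset hIS, Nat.cast_sub (Finset.card_le_card hIS)]
    by_cases h : ((S \ I).card : ℝ) ≤ s₀
    -- The extraction that crosses `s₀` is paid for by the `+ 1`; every earlier one is charged to
    -- the potential.
    · refine ⟨Q + 1, (hQ _ h).succ_of_sdiff hind, ?_⟩
      have h1 := hφ s₀ S.card le_rfl hS.le
      have h2 : 0 ≤ ((S.card : ℝ) - s₀) * D S.card :=
        mul_nonneg (by linarith) (hD _ hS.le)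
      have : 0 ≤ (S.card - s₀ + (φ S.card - φ s₀)) / k := by
        apply div_nonneg _ hk.le
        linarith
      push_cast
      linarith
    · push Not at h
      obtain ⟨m, hm, hmle⟩ := ih (S \ I) (Finset.sdiff_ssubset hIS (Finset.card_pos.1 hIc)) h
      refine ⟨m + 1, hm.succ_of_sdiff hind, ?_⟩
      have h1 := hφ (S \ I).card S.card h.le (by rw [hc]; linarith [Nat.cast_nonneg (α := ℝ) I.card])
      -- `φ` plays the role of an antiderivative of `D`: extracting `I` lowers `s + φ(s)` by at
      -- least `|I|(1 + D) ≥ k`, so the costs telescope.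
      have h2 : 1 ≤ ((S.card : ℝ) - (S \ I).card + (φ S.card - φ (S \ I).card)) / k := by
        rw [le_div_iff₀ hk, one_mul]
        have : (S.card : ℝ) - (S \ I).card = I.card := by rw [hc]; ring
        rw [this] at h1 ⊢
        linarith
      push_cast
      have h3 : (S.card - s₀ + (φ S.card - φ s₀)) / k =
          ((S \ I).card - s₀ + (φ (S \ I).card - φ s₀)) / k +
          ((S.card : ℝ) - (S \ I).card + (φ S.card - φ (S \ I).card)) / k := by ring
      rw [h3]
      linarith

theorem disjoint_pairs_iff {A : Finset (Sym2 V)} {K : Finset V} (hd : Disjoint (pairs K) A) :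
    ∀ u ∈ K, ∀ v ∈ K, ¬ (SimpleGraph.fromEdgeSet (A : Set (Sym2 V))).Adj u v := by
  intro u hu v hv h
  rw [SimpleGraph.fromEdgeSet_adj] at h
  exact Finset.disjoint_left.1 hd (mk_mem_pairs.2 ⟨⟨hu, hv⟩, h.2⟩) (by exact_mod_cast h.1)

open Classical in
/-- A large fractional packing of independent sets contains a set spanning few edges of `H`. -/
theorem exists_edgesIn_mul_le {A : Finset (Sym2 V)} {k : ℕ} {x : ℝ} (hx : 0 ≤ x)
    (h : x < fracPackingNumber (S.powersetCard k) pairs A) (H : SimpleGraph V) :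
    ∃ K ∈ S.powersetCard k, Disjoint (pairs K) A ∧ edgesIn H K * x ≤ edgesIn H S := by
  obtain ⟨w, hw, hxw⟩ := exists_isFracPacking_of_lt h
  by_contra! hcon
  -- Exchanging the sums, each edge of `H` inside `S` is counted with its covering weight, which is
  -- at most 1. With total weight above `x`, not every set of positive weight can then span more
  -- than `e_H(S)/x` edges.
  have hcover : ∑ K ∈ S.powersetCard k, w K * edgesIn H K ≤ edgesIn H S := by
    calc _ = ∑ K ∈ S.powersetCard k, ∑ e ∈ (pairs S).filter (fun e => e ∈ H.edgeSet),
          if e ∈ pairs K then w K else 0 := by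
          refine Finset.sum_congr rfl fun K hK => ?_
          rw [← Finset.sum_filter, Finset.sum_const, nsmul_eq_mul, mul_comm, edgesIn]
          congr 3
          ext e
          simp only [Finset.mem_filter]
          have := @pairs_mono _ _ _ _ (Finset.mem_powersetCard.1 hK).1 e
          tauto
      _ = ∑ e ∈ (pairs S).filter (fun e => e ∈ H.edgeSet),
          ∑ K ∈ S.powersetCard k with e ∈ pairs K, w K := by
          rw [Finset.sum_comm]
          exact Finset.sum_congr rfl fun e _ => (Finset.sum_filter _ _).symm
      _ ≤ ∑ e ∈ (pairs S).filter (fun e => e ∈ H.edgeSet), 1 := by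
          refine Finset.sum_le_sum fun e _ => ?_
          convert hw.cover_le e
      _ = _ := by simp [edgesIn]
  have hpos : ∃ K ∈ S.powersetCard k, 0 < w K := by
    by_contra! hle
    have := Finset.sum_nonpos hle
    linarith
  obtain ⟨K₀, hK₀, hw₀⟩ := hpos
  have hE : ∀ K ∈ S.powersetCard k, 0 < w K → (edgesIn H S : ℝ) < edgesIn H K * x := by
    intro K hK hwK
    refine hcon K hK ?_
    by_contra hd
    exact hwK.ne' (hw.eq_zero K hK hd)
  have h1 : (∑ K ∈ S.powersetCard k, w K) * edgesIn H S <
      (∑ K ∈ S.powersetCard k, w K * edgesIn H K) * x := by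
    rw [Finset.sum_mul, Finset.sum_mul]
    refine Finset.sum_lt_sum (fun K hK => ?_) ⟨K₀, hK₀, ?_⟩
    · rcases (hw.nonneg K).eq_or_lt with h0 | h0
      · rw [← h0]; simp
      · rw [mul_assoc]; exact mul_le_mul_of_nonneg_left (hE K hK h0).le h0.le
    · rw [mul_assoc]; exact mul_lt_mul_of_pos_left (hE K₀ hK₀ hw₀) hw₀
  have h2 : (∑ K ∈ S.powersetCard k, w K * edgesIn H K) * x ≤ edgesIn H S * x :=
    mul_le_mul_of_nonneg_right hcover hx
  have h3 : x * edgesIn H S ≤ (∑ K ∈ S.powersetCard k, w K) * edgesIn H S :=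
    mul_le_mul_of_nonneg_right hxw.le (Nat.cast_nonneg _)
  linarith

theorem two_mul_edgesIn_le_of_degree_le {d : ℝ} (hd : ∀ v ∈ T, (degreeIn H T v : ℝ) ≤ d) :
    2 * (edgesIn H T : ℝ) ≤ T.card * d := by
  have : (2 * edgesIn H T : ℝ) = ∑ v ∈ T, (degreeIn H T v : ℝ) := by
    exact_mod_cast (sum_degreeIn H T).symm
  rw [this, ← nsmul_eq_mul]
  exact Finset.sum_le_card_nsmul _ _ _ hd

end Coloring

theorem chi_le_of_colorableOn {n m : ℕ} {G : SimpleGraph (Fin n)}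
    (h : ColorableOn G Finset.univ m) : chi G ≤ m := by
  obtain ⟨c, h1, h2⟩ := h
  have hc : G.Colorable m := ⟨SimpleGraph.Coloring.mk
    (fun v => (⟨c v, h1 v (Finset.mem_univ v)⟩ : Fin m)) fun {u v} huv h' =>
      h2 u (Finset.mem_univ u) v (Finset.mem_univ v) huv (by simpa using h')⟩
  exact ENat.toNat_le_of_le_natCast hc.chromaticNumber_le

-- Graphs correspond to sets of off-diagonal pairs through their edge sets, which turns the measure
-- into a finite weighted sum.
open Classical in
theorem binomialRandom_real_eq {n : ℕ} (p : unitInterval) (P : SimpleGraph (Fin n) → Prop) :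
    (SimpleGraph.binomialRandom (Fin n) p).real {G | P G} =
      bernoulliExp p (pairs Finset.univ) fun A : Finset (Sym2 (Fin n)) =>
        if P (SimpleGraph.fromEdgeSet (A : Set (Sym2 (Fin n)))) then 1 else 0 := by
  have : MeasurableSingletonClass (SimpleGraph (Fin n)) := ⟨fun G => by
    rw [show ({G} : Set (SimpleGraph (Fin n))) = SimpleGraph.edgeSet ⁻¹' {G.edgeSet} by ext; simp]
    exact SimpleGraph.measurable_edgeSet (measurableSet_singleton _)⟩
  have h1 : {G | P G} = ((Finset.univ.filter P : Finset (SimpleGraph (Fin n))) : Set _) := by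
    ext; simp
  rw [h1, ← MeasureTheory.sum_measureReal_singleton, Finset.sum_filter, bernoulliExp]
  have hmem : ∀ e : Sym2 (Fin n), e ∈ pairs Finset.univ ↔ ¬ e.IsDiag := by
    intro e; simp [pairs]
  refine Finset.sum_bij' (fun G _ => G.edgeFinset)
    (fun A _ => SimpleGraph.fromEdgeSet (A : Set (Sym2 (Fin n)))) ?_ ?_ ?_ ?_ ?_
  · intro G _
    rw [Finset.mem_powerset]
    intro e he
    rw [hmem]
    exact G.not_isDiag_of_mem_edgeSet (SimpleGraph.mem_edgeFinset.1 he)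
  · intro A _; exact Finset.mem_univ _
  · intro G _; simp
  · intro A hA
    ext e
    simp only [SimpleGraph.mem_edgeFinset, SimpleGraph.edgeSet_fromEdgeSet, Set.mem_sdiff, Finset.mem_coe]
    constructor
    · exact fun h => h.1
    · exact fun h => ⟨h, (hmem e).1 (Finset.mem_powerset.1 hA h)⟩
  · intro G _
    rw [SimpleGraph.coe_edgeFinset, SimpleGraph.fromEdgeSet_edgeSet, mul_ite, mul_one, mul_zero]
    refine if_congr Iff.rfl ?_ rfl
    rw [MeasureTheory.measureReal_def, SimpleGraph.binomialRandom_singleton, card_pairs,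
      Finset.card_univ, ← SimpleGraph.coe_edgeFinset, Set.ncard_coe_finset]
    simp [unitInterval.coe_toNNReal]

/-! ### Typical properties of the random graph -/

section Concentration

variable {n k : ℕ} {p s₀ t₀ : ℝ}

-- The mean is at least twice the threshold, so failure is a downward deviation of at least `x`. The
-- tilt `l = x/(pn²)` balances the two terms and gives exponent `-x²/(2pn²)`; `h1` keeps `l ≤ 1` and
-- `h2` makes the exponent at most `-2n`.
open Classical in
theorem fracPackingNumber_pairs_tail (hp0 : 0 < p) (hp : p ≤ 1 / 2) (hk : 2 ≤ k)
    {S : Finset (Fin n)} (hs₀ : 0 ≤ s₀) (hS : s₀ ≤ S.card) (hkS : k ≤ S.card)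
    (hR : 2 * (k : ℝ) ^ 2 * overlapBound (1 / (1 - p)) S.card k ≤ 1)
    (h1 : s₀ ^ 2 / (16 * (k : ℝ) ^ 2) ≤ p * n ^ 2)
    (h2 : 4 * p * (n : ℝ) ^ 3 ≤ (s₀ ^ 2 / (16 * (k : ℝ) ^ 2)) ^ 2) :
    bernoulliExp p (pairs Finset.univ) (fun A =>
      if fracPackingNumber (S.powersetCard k) pairs A ≤ (S.card : ℝ) ^ 2 / (16 * (k : ℝ) ^ 2)
      then 1 else 0) ≤ Real.exp (-(2 * n)) := by
  set x := s₀ ^ 2 / (16 * (k : ℝ) ^ 2) with hx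
  have hk' : (2 : ℝ) ≤ k := by exact_mod_cast hk
  have hn : (0 : ℝ) < n := by
    have := S.card_le_univ
    rw [Fintype.card_fin] at this
    exact_mod_cast (by omega : 0 < n)
  have hE := le_bernoulliExp_fracPackingNumber_pairs hp0.le hp
    (pairs_mono (Finset.subset_univ S)) hk hkS hR
  have hQ : ∀ K ∈ S.powersetCard k, (pairs K).Nonempty := by
    intro K hK
    rw [← Finset.card_pos, card_pairs, (Finset.mem_powersetCard.1 hK).2]
    exact Nat.choose_pos hk
  have hx0 : 0 ≤ x := by positivity
  have hxS : x ≤ (S.card : ℝ) ^ 2 / (16 * (k : ℝ) ^ 2) := by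
    rw [hx]; gcongr
  set y := (S.card : ℝ) ^ 2 / (16 * (k : ℝ) ^ 2) with hy
  have hy2 : (S.card : ℝ) ^ 2 / (8 * (k : ℝ) ^ 2) = 2 * y := by
    rw [hy]; field_simp; ring
  rw [hy2] at hE
  set l := x / (p * n ^ 2) with hl
  have hpn : 0 < p * (n : ℝ) ^ 2 := by positivity
  have hl0 : 0 ≤ l := by positivity
  have hl1 : l ≤ 1 := by rw [hl, div_le_one hpn]; exact h1
  have key := bernoulliExp_tail_le (U := pairs (Finset.univ : Finset (Fin n))) (c := fun _ => 1)
    (l := -l) (t := l * x) hp0.le (by linarith) (fun _ => le_rfl)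
    (by rw [abs_neg, abs_of_nonneg hl0]; exact hl1)
    (fun a A => abs_fracPackingNumber_insert_sub_le (A := A) hQ a)
  refine le_trans (bernoulliExp_mono hp0.le (by linarith) fun A _ => ?_) (key.trans ?_)
  · by_cases h : fracPackingNumber (S.powersetCard k) pairs A ≤ y
    · rw [if_pos h, if_pos]
      nlinarith
    · rw [if_neg h]
      split_ifs <;> norm_num
  · rw [Real.exp_le_exp]
    simp only [one_pow, Finset.sum_const, nsmul_eq_mul, mul_one, card_pairs, Finset.card_univ,
      Fintype.card_fin, neg_sq]
    rw [Nat.cast_choose_two]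
    have e1 : l ^ 2 * p * ((n : ℝ) * (n - 1) / 2) ≤ l ^ 2 * p * (n ^ 2 / 2) := by
      gcongr
      nlinarith
    have e2 : l ^ 2 * p * ((n : ℝ) ^ 2 / 2) = x ^ 2 / (2 * (p * n ^ 2)) := by
      rw [hl]; field_simp
    have e3 : l * x = x ^ 2 / (p * n ^ 2) := by rw [hl]; ring
    have e4 : x ^ 2 / (p * n ^ 2) = 2 * (x ^ 2 / (2 * (p * n ^ 2))) := by field_simp
    have e5 : 2 * (n : ℝ) ≤ x ^ 2 / (2 * (p * n ^ 2)) := by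
      rw [le_div_iff₀ (by positivity)]
      nlinarith
    rw [e3]
    linarith

-- The mean is at most `p|T|²/2`, so failure is an upward deviation of at least `p|T|²/2`. Only the
-- pairs of `T` contribute to the variance, and the tilt `1/2` gives exponent at most `-p|T|²/8 ≤
-- -2n`.
open Classical in
theorem card_pairs_inter_tail (hp0 : 0 < p) (hp : p ≤ 1 / 2) {T : Finset (Fin n)}
    (ht₀ : 0 ≤ t₀) (hT : t₀ ≤ T.card) (h : 16 * (n : ℝ) ≤ p * t₀ ^ 2) :
    bernoulliExp p (pairs Finset.univ) (fun A =>
      if p * (T.card : ℝ) ^ 2 < (pairs T ∩ A).card then 1 else 0) ≤ Real.exp (-(2 * n)) := by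
  have hsub : pairs T ⊆ pairs (Finset.univ : Finset (Fin n)) := pairs_mono (Finset.subset_univ T)
  have key := bernoulliExp_tail_le (U := pairs (Finset.univ : Finset (Fin n)))
    (c := fun e => if e ∈ pairs T then 1 else 0) (l := 1 / 2) (t := p * (T.card : ℝ) ^ 2 / 4)
    (f := fun A => ((pairs T ∩ A).card : ℝ)) hp0.le (by linarith)
    (fun _ => by split_ifs <;> norm_num) (by rw [abs_of_pos] <;> norm_num)
    (fun a A => by
      by_cases ha : a ∈ pairs T
      · rw [if_pos ha, Finset.inter_insert_of_mem ha]
        have c1 := Finset.card_le_card (Finset.subset_insert a (pairs T ∩ A))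
        have c2 := Finset.card_insert_le a (pairs T ∩ A)
        rw [abs_of_nonneg (sub_nonneg.2 (by exact_mod_cast c1)), sub_le_iff_le_add']
        exact_mod_cast c2
      · rw [if_neg ha, Finset.inter_insert_of_notMem ha, sub_self, abs_zero])
  have hch : ((pairs T).card : ℝ) ≤ (T.card : ℝ) ^ 2 / 2 := by
    rw [card_pairs, Nat.cast_choose_two]
    nlinarith [Nat.cast_nonneg (α := ℝ) T.card]
  rw [bernoulliExp_card_inter hsub] at key
  refine le_trans (bernoulliExp_mono hp0.le (by linarith) fun A _ => ?_) (key.trans ?_)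
  · by_cases h : p * (T.card : ℝ) ^ 2 < (pairs T ∩ A).card
    · rw [if_pos h, if_pos]
      nlinarith
    · rw [if_neg h]
      split_ifs <;> norm_num
  · rw [Real.exp_le_exp]
    have e1 : ∑ a ∈ pairs (Finset.univ : Finset (Fin n)),
        (if a ∈ pairs T then (1 : ℝ) else 0) ^ 2 = (pairs T).card := by
      simp only [ite_pow, one_pow, ne_eq, OfNat.ofNat_ne_zero, not_false_eq_true, zero_pow]
      rw [← Finset.sum_filter, Finset.sum_const, nsmul_one, Finset.filter_mem_eq_inter,
        Finset.inter_eq_right.2 hsub]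
    rw [e1]
    have e2 : t₀ ^ 2 ≤ (T.card : ℝ) ^ 2 := by gcongr
    nlinarith

/-- Every large vertex set `S` supports a large fractional packing of independent `k`-sets, and no
large vertex set spans many more edges than expected. -/
def IsTypical (p s₀ t₀ : ℝ) (k : ℕ) (A : Finset (Sym2 (Fin n))) : Prop :=
  (∀ S : Finset (Fin n), s₀ ≤ S.card →
    (S.card : ℝ) ^ 2 / (16 * (k : ℝ) ^ 2) < fracPackingNumber (S.powersetCard k) pairs A) ∧
  ∀ T : Finset (Fin n), t₀ ≤ T.card → ((pairs T ∩ A).card : ℝ) ≤ p * (T.card : ℝ) ^ 2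

-- Union bound over the `2^n` choices of `S` and of `T`, using `2^n exp(-2n) ≤ exp(-n)`.
open Classical in
theorem bernoulliExp_not_isTypical_le (hp0 : 0 < p) (hp : p ≤ 1 / 2) (hk : 2 ≤ k)
    (hs₀ : 0 ≤ s₀) (ht₀ : 0 ≤ t₀) (hks : (k : ℝ) ≤ s₀)
    (hR : ∀ s : ℕ, s₀ ≤ s → 2 * (k : ℝ) ^ 2 * overlapBound (1 / (1 - p)) s k ≤ 1)
    (h1 : s₀ ^ 2 / (16 * (k : ℝ) ^ 2) ≤ p * n ^ 2)
    (h2 : 4 * p * (n : ℝ) ^ 3 ≤ (s₀ ^ 2 / (16 * (k : ℝ) ^ 2)) ^ 2)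
    (h3 : 16 * (n : ℝ) ≤ p * t₀ ^ 2) :
    bernoulliExp p (pairs (Finset.univ : Finset (Fin n)))
      (fun A => if IsTypical p s₀ t₀ k A then 0 else 1) ≤ 2 * Real.exp (-n) := by
  set F : Finset (Fin n) → Finset (Sym2 (Fin n)) → ℝ := fun S A => if s₀ ≤ S.card then
    (if fracPackingNumber (S.powersetCard k) pairs A ≤ (S.card : ℝ) ^ 2 / (16 * (k : ℝ) ^ 2)
      then 1 else 0) else 0 with hF
  set F' : Finset (Fin n) → Finset (Sym2 (Fin n)) → ℝ := fun T A => if t₀ ≤ T.card then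
    (if p * (T.card : ℝ) ^ 2 < (pairs T ∩ A).card then 1 else 0) else 0 with hF'
  have hF0 : ∀ S A, 0 ≤ F S A := fun S A => by
    simp only [hF]; split_ifs <;> norm_num
  have hF'0 : ∀ S A, 0 ≤ F' S A := fun S A => by
    simp only [hF']; split_ifs <;> norm_num
  have hbound : ∀ S, bernoulliExp p (pairs (Finset.univ : Finset (Fin n))) (F S) ≤
      Real.exp (-(2 * n)) := by
    intro S
    by_cases h : s₀ ≤ S.card
    · simp only [hF, if_pos h]
      exact fracPackingNumber_pairs_tail hp0 hp hk hs₀ h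
        (by exact_mod_cast hks.trans h) (hR _ h) h1 h2
    · simp only [hF, if_neg h, bernoulliExp_const]
      positivity
  have hbound' : ∀ T, bernoulliExp p (pairs (Finset.univ : Finset (Fin n))) (F' T) ≤
      Real.exp (-(2 * n)) := by
    intro T
    by_cases h : t₀ ≤ T.card
    · simp only [hF', if_pos h]
      exact card_pairs_inter_tail hp0 hp ht₀ h h3
    · simp only [hF', if_neg h, bernoulliExp_const]
      positivity
  calc _ ≤ bernoulliExp p (pairs (Finset.univ : Finset (Fin n)))
        (fun A => ∑ S : Finset (Fin n), F S A + ∑ T : Finset (Fin n), F' T A) := by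
        refine bernoulliExp_mono hp0.le (by linarith) fun A _ => ?_
        have n1 := Finset.sum_nonneg fun S (_ : S ∈ Finset.univ) => hF0 S A
        have n2 := Finset.sum_nonneg fun S (_ : S ∈ Finset.univ) => hF'0 S A
        split_ifs with hA
        · linarith
        · rw [IsTypical, not_and_or] at hA
          push Not at hA
          rcases hA with ⟨S, hS, hle⟩ | ⟨T, hT, hlt⟩
          · have := Finset.single_le_sum (f := fun S => F S A) (fun S _ => hF0 S A)
              (Finset.mem_univ S)
            simp only [hF, if_pos hS, if_pos hle] at this n1
            linarith
          · have := Finset.single_le_sum (f := fun S => F' S A) (fun S _ => hF'0 S A)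
              (Finset.mem_univ T)
            simp only [hF', if_pos hT, if_pos hlt] at this n2
            linarith
    _ ≤ 2 ^ n * Real.exp (-(2 * n)) + 2 ^ n * Real.exp (-(2 * n)) := by
        rw [bernoulliExp_add, bernoulliExp_sum, bernoulliExp_sum]
        have hc : (Finset.univ : Finset (Finset (Fin n))).card = 2 ^ n := by simp
        refine add_le_add ?_ ?_
        · refine (Finset.sum_le_card_nsmul _ _ _ fun S _ => hbound S).trans_eq ?_
          rw [hc, nsmul_eq_mul]; push_cast; rfl
        · refine (Finset.sum_le_card_nsmul _ _ _ fun S _ => hbound' S).trans_eq ?_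
          rw [hc, nsmul_eq_mul]; push_cast; rfl
    _ = 2 * (2 ^ n * Real.exp (-(2 * n))) := by ring
    _ ≤ 2 * (Real.exp n * Real.exp (-(2 * n))) := by
        have : (2 : ℝ) ^ n ≤ Real.exp n := by
          rw [← Real.exp_one_pow]
          have := Real.add_one_le_exp (1 : ℝ)
          gcongr
          linarith
        gcongr
    _ = _ := by rw [← Real.exp_add]; ring_nf

end Concentration

/-! ### Deterministic resilience of typical graphs -/

section Resilience

variable {n k : ℕ} {p s₀ t₀ : ℝ} {A : Finset (Sym2 (Fin n))}

theorem edgesIn_fromEdgeSet_le {V : Type*} [DecidableEq V] (A : Finset (Sym2 V)) (T : Finset V) :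
    edgesIn (SimpleGraph.fromEdgeSet (A : Set (Sym2 V))) T ≤ (pairs T ∩ A).card := by
  classical
  refine Finset.card_le_card fun e he => ?_
  simp only [Finset.mem_filter, SimpleGraph.edgeSet_fromEdgeSet] at he
  exact Finset.mem_inter.2 ⟨he.1, he.2.1⟩

/-- In the union of a typical graph and a graph `H` with few edges on each large vertex set, large
vertex sets contain large independent sets. -/
theorem IsTypical.exists_indep (hA : IsTypical p s₀ t₀ k A) (hk : 0 < k) (H : SimpleGraph (Fin n))
    {S : Finset (Fin n)} (hs₀ : 0 < s₀) (hS : s₀ ≤ S.card) {d : ℝ}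
    (hd : 32 * k * (edgesIn H S : ℝ) ≤ d * (S.card : ℝ) ^ 2) :
    ∃ I ⊆ S, (∀ u ∈ I, ∀ v ∈ I,
      ¬ (SimpleGraph.fromEdgeSet (A : Set (Sym2 (Fin n))) ⊔ H).Adj u v) ∧
      (k : ℝ) ≤ I.card * (1 + d) := by
  have hk' : (0 : ℝ) < k := by exact_mod_cast hk
  have hSc : (0 : ℝ) < S.card := hs₀.trans_le hS
  obtain ⟨K, hK, hdis, hKe⟩ := exists_edgesIn_mul_le (by positivity) (hA.1 S hS) H
  obtain ⟨hKS, hKc⟩ := Finset.mem_powersetCard.1 hK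
  obtain ⟨I, hIK, hI, hIc⟩ := exists_indep_card_mul_ge H K
  refine ⟨I, hIK.trans hKS, fun u hu v hv h => ?_, ?_⟩
  · rcases h with h | h
    · exact disjoint_pairs_iff hdis u (hIK hu) v (hIK hv) h
    · exact hI u hu v hv h
  · rw [hKc] at hIc
    have h1 : 2 * (edgesIn H K : ℝ) ≤ k * d := by
      rw [mul_div_assoc', div_le_iff₀ (by positivity)] at hKe
      have h2 : 2 * (edgesIn H K : ℝ) * (S.card ^ 2 * k) ≤ k * d * (S.card ^ 2 * k) := by
        nlinarith
      exact le_of_mul_le_mul_right h2 (by positivity)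
    have h3 : (k : ℝ) ^ 2 ≤ I.card * (1 + d) * k := by
      calc (k : ℝ) ^ 2 ≤ I.card * (k + 2 * edgesIn H K) := hIc
        _ ≤ I.card * (k + k * d) := by gcongr
        _ = _ := by ring
    exact le_of_mul_le_mul_right (by rw [← sq]; exact h3) hk'

/-- Small vertex sets can be coloured greedily in the union of a typical graph and a sparse
graph `H`. -/
theorem IsTypical.colorableOn_of_card_le (hp : 0 ≤ p) (hA : IsTypical p s₀ t₀ k A)
    (H : SimpleGraph (Fin n)) {Q : ℕ} (hQ : t₀ ≤ Q)
    (hH : ∀ T : Finset (Fin n), T.Nonempty → t₀ ≤ T.card → (T.card : ℝ) ≤ s₀ →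
      2 * (edgesIn H T : ℝ) < (Q - 2 * p * s₀) * T.card)
    {S : Finset (Fin n)} (hS : (S.card : ℝ) ≤ s₀) :
    ColorableOn (SimpleGraph.fromEdgeSet (A : Set (Sym2 (Fin n))) ⊔ H) S Q := by
  refine colorableOn_of_degenerate fun T hTS hT => ?_
  by_cases hTt : t₀ ≤ T.card
  · obtain ⟨v, hv, hdeg⟩ := exists_degreeIn_mul_card_le
      (G := SimpleGraph.fromEdgeSet (A : Set (Sym2 (Fin n))) ⊔ H) hT
    refine ⟨v, hv, ?_⟩
    have hTc : (0 : ℝ) < T.card := by exact_mod_cast Finset.card_pos.2 hT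
    have hTs : (T.card : ℝ) ≤ s₀ := le_trans (by exact_mod_cast Finset.card_le_card hTS) hS
    have h1 : (edgesIn (SimpleGraph.fromEdgeSet (A : Set (Sym2 (Fin n))) ⊔ H) T : ℝ) ≤
        p * (T.card : ℝ) ^ 2 + edgesIn H T := by
      have e1 : (edgesIn (SimpleGraph.fromEdgeSet (A : Set (Sym2 (Fin n))) ⊔ H) T : ℝ) ≤
          (pairs T ∩ A).card + edgesIn H T := by
        exact_mod_cast (edgesIn_sup_le _ _ _).trans
          (Nat.add_le_add_right (edgesIn_fromEdgeSet_le A T) _)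
      linarith [hA.2 T hTt]
    have h2 := hH T hT hTt hTs
    have h3 : (degreeIn (SimpleGraph.fromEdgeSet (A : Set (Sym2 (Fin n))) ⊔ H) T v : ℝ) * T.card ≤
        2 * edgesIn (SimpleGraph.fromEdgeSet (A : Set (Sym2 (Fin n))) ⊔ H) T := by
      exact_mod_cast hdeg
    have h4 : 2 * (p * (T.card : ℝ) ^ 2) ≤ 2 * p * s₀ * T.card := by
      have : p * T.card * T.card ≤ p * T.card * s₀ :=
        mul_le_mul_of_nonneg_left hTs (by positivity)
      nlinarith
    have h5 : (degreeIn (SimpleGraph.fromEdgeSet (A : Set (Sym2 (Fin n))) ⊔ H) T v : ℝ) * T.card <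
        Q * T.card := by linarith
    exact_mod_cast lt_of_mul_lt_mul_right h5 hTc.le
  -- Below `t₀` no edge count is needed: degrees are smaller than `|T| < t₀ ≤ Q`.
  · push Not at hTt
    obtain ⟨v, hv⟩ := hT
    refine ⟨v, hv, (degreeIn_lt_card hv).trans ?_⟩
    exact_mod_cast hTt.trans_le hQ

/-- The chromatic number of the union of a typical graph with a graph `H`. -/
theorem IsTypical.chi_le (hp : 0 ≤ p) (hA : IsTypical p s₀ t₀ k A) (hk : 0 < k)
    (H : SimpleGraph (Fin n)) {Q : ℕ} (hs₀ : 0 < s₀) (hsn : s₀ < n) (hQ : t₀ ≤ Q)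
    (hH : ∀ T : Finset (Fin n), T.Nonempty → t₀ ≤ T.card → (T.card : ℝ) ≤ s₀ →
      2 * (edgesIn H T : ℝ) < (Q - 2 * p * s₀) * T.card)
    {D φ : ℝ → ℝ}
    (hHD : ∀ S : Finset (Fin n), s₀ < S.card →
      32 * k * (edgesIn H S : ℝ) ≤ D S.card * (S.card : ℝ) ^ 2)
    (hD : ∀ s, s₀ ≤ s → 0 ≤ D s)
    (hφ : ∀ s' s, s₀ ≤ s' → s' ≤ s → (s - s') * D s ≤ φ s - φ s') :
    (chi (SimpleGraph.fromEdgeSet (A : Set (Sym2 (Fin n))) ⊔ H) : ℝ) ≤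
      Q + 1 + (n + (φ n - φ s₀)) / k := by
  have hk' : (0 : ℝ) < k := by exact_mod_cast hk
  obtain ⟨m, hm, hmle⟩ := exists_colorableOn_of_extraction hk'
    (fun S hS => hA.colorableOn_of_card_le hp H hQ hH hS)
    (fun S hS => hA.exists_indep hk H hs₀ hS.le (hHD S hS)) hD hφ Finset.univ
    (by simpa using hsn)
  have h1 : (chi (SimpleGraph.fromEdgeSet (A : Set (Sym2 (Fin n))) ⊔ H) : ℝ) ≤ m := by
    exact_mod_cast chi_le_of_colorableOn hm
  refine h1.trans (hmle.trans ?_)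
  rw [Finset.card_univ, Fintype.card_fin]
  gcongr
  linarith

/-- Numerical conditions, valid for all large `n`, under which typical graphs are resilient; here
`l` stands for `log_b (np)`. -/
structure ResilienceParams (ε p l : ℝ) (n k : ℕ) : Prop where
  p_pos : 0 < p
  p_le : p ≤ 1 / 2
  l_pos : 0 < l
  log_le : Real.log n ≤ 3 * p * l
  p_mul_le : p * l ≤ Real.log n
  two_le : 2 ≤ k
  inv_le : 1 / (k : ℝ) ≤ (1 + ε / 4) / (2 * l)
  large : 40 ≤ ε * n / (2 * l)
  log_large : 16 / ε < Real.log n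
  log_large' : 1 + ε ≤ Real.log n
  loglog_large : 1 ≤ Real.log (Real.log n)

variable {ε l : ℝ}

/-- The allowance is `n/(2l) + u/2` with `u = εn/l`. The part `n/k` exceeds `n/(2l)` by at most
`u/8`, the added graph costs `3u/16`, the greedy remainder `0.15u + 1` and the last extraction 1; as
`u ≥ 80` this fits. Of the `0.15u` greedy colours, `u/8` absorb the edges of `G`, leaving at least
`0.02u` for `H`. -/
theorem ResilienceParams.chi_le (h : ResilienceParams ε p l n k) (hε : 0 < ε)
    (hA : IsTypical p (ε * n / (16 * Real.log n)) (ε * n / (16 * l)) k A)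
    (H : SimpleGraph (Fin n))
    (hH : ∀ T : Finset (Fin n), T.Nonempty → ε * n / (16 * l) ≤ T.card →
      2 * (edgesIn H T : ℝ) < (2 / 100 * (ε * n / l)) * T.card)
    {D φ : ℝ → ℝ}
    (hHD : ∀ S : Finset (Fin n), ε * n / (16 * Real.log n) < S.card →
      32 * k * (edgesIn H S : ℝ) ≤ D S.card * (S.card : ℝ) ^ 2)
    (hD : ∀ s, ε * n / (16 * Real.log n) ≤ s → 0 ≤ D s)
    (hφ : ∀ s' s, ε * n / (16 * Real.log n) ≤ s' → s' ≤ s → (s - s') * D s ≤ φ s - φ s')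
    (hφ' : (φ n - φ (ε * n / (16 * Real.log n))) / k ≤ 3 / 16 * (ε * n / l)) :
    (chi (SimpleGraph.fromEdgeSet (A : Set (Sym2 (Fin n))) ⊔ H) : ℝ) ≤
      (1 + ε) * (n / (2 * l)) := by
  obtain ⟨hp0, hp, hl, hLl, hpl, hk2, hkl, hU, hL1, hL2, hLL⟩ := h
  have hn : (0 : ℝ) < n := by
    rcases (Nat.cast_nonneg (α := ℝ) n).eq_or_lt with h | h
    · rw [← h] at hU; norm_num at hU
    · exact h
  have hL : 0 < Real.log n := by linarith
  set L := Real.log n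
  set s₀ := ε * n / (16 * L) with hs₀
  have hs₀pos : 0 < s₀ := by positivity
  set u := ε * n / l with hu
  have hu0 : 0 < u := by positivity
  have hU' : 80 ≤ u := by
    have : ε * n / (2 * l) = u / 2 := by rw [hu]; field_simp
    linarith
  have hps : 2 * p * s₀ ≤ u / 8 := by
    rw [hs₀, hu]
    have : 2 * p * (ε * n / (16 * L)) = (p / L) * (ε * n / 8) := by field_simp; norm_num
    rw [this]
    have h2 : p / L ≤ 1 / l := by rw [div_le_div_iff₀ hL hl]; linarith
    calc p / L * (ε * n / 8) ≤ 1 / l * (ε * n / 8) := by gcongr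
      _ = _ := by field_simp
  have hsn : s₀ < n := by
    rw [hs₀, div_lt_iff₀ (by positivity)]
    nlinarith
  have ht0 : ε * n / (16 * l) = u / 16 := by rw [hu]; field_simp
  rw [ht0] at hA hH
  have hQ1 : (15 / 100 : ℝ) * u ≤ ⌈(15 / 100 : ℝ) * u⌉₊ := Nat.le_ceil _
  have hQ2 : (⌈(15 / 100 : ℝ) * u⌉₊ : ℝ) < 15 / 100 * u + 1 := Nat.ceil_lt_add_one (by positivity)
  have main := hA.chi_le hp0.le (by omega) H (Q := ⌈(15 / 100 : ℝ) * u⌉₊) hs₀pos hsn (by linarith)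
    (fun T hT hT1 _ => (hH T hT hT1).trans_le (by gcongr; linarith)) hHD hD hφ
  refine main.trans ?_
  have h1 : (n : ℝ) / k ≤ n / (2 * l) + u / 8 := by
    calc (n : ℝ) / k = n * (1 / k) := by ring
      _ ≤ n * ((1 + ε / 4) / (2 * l)) := by gcongr
      _ = _ := by rw [hu]; field_simp; ring
  have h2 : (1 + ε) * (n / (2 * l)) = n / (2 * l) + u / 2 := by rw [hu]; field_simp
  rw [h2, add_div]
  linarith

/-- Every `S` is allowed the whole budget of added edges, so `D(s) = a/s²` with potential `-a/s`,
and the total cost is at most `a/(s₀k) = (u/8)(log n/l)`, where `u = εn/l`. -/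
theorem ResilienceParams.globallyResilient (h : ResilienceParams ε p l n k) (hε : 0 < ε)
    (hl : l = logbNP n p)
    (hA : IsTypical p (ε * n / (16 * Real.log n)) (ε * n / (16 * l)) k A) :
    GloballyResilient ε n p (SimpleGraph.fromEdgeSet (A : Set (Sym2 (Fin n)))) := by
  intro E _ hEc
  rw [chiBound]
  rw [← hl] at hEc ⊢
  have h' := h
  obtain ⟨hp0, hp, hl, hLl, hpl, hk2, hkl, hU, hL1, hL2, hLL⟩ := h
  have hn : (0 : ℝ) < n := by
    rcases (Nat.cast_nonneg (α := ℝ) n).eq_or_lt with h | h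
    · rw [← h] at hU; norm_num at hU
    · exact h
  have hL : 0 < Real.log n := by linarith
  have hk : (0 : ℝ) < k := by exact_mod_cast (by omega : 0 < k)
  have hedge : ∀ T : Finset (Fin n),
      (edgesIn (SimpleGraph.fromEdgeSet (E : Set (Sym2 (Fin n)))) T : ℝ) ≤
        (2 : ℝ)⁻¹ ^ 12 * ε ^ 2 * ((n : ℝ) ^ 2 / l ^ 2) := fun T => by
    refine le_trans ?_ hEc
    exact_mod_cast (edgesIn_fromEdgeSet_le E T).trans (Finset.card_le_card Finset.inter_subset_right)
  set a := 32 * k * ((2 : ℝ)⁻¹ ^ 12 * ε ^ 2 * ((n : ℝ) ^ 2 / l ^ 2)) with ha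
  have ha0 : 0 ≤ a := by positivity
  set L := Real.log n
  have hs₀ : 0 < ε * n / (16 * L) := by positivity
  refine h'.chi_le hε hA _ (fun T hT hTc => ?_) (D := fun s => a / s ^ 2) (φ := fun s => -(a / s))
    (fun S hS => ?_) (fun s _ => by positivity) (fun s' s h1 h2 => ?_) ?_
  · have h1 : 2 * ((2 : ℝ)⁻¹ ^ 12 * ε ^ 2 * ((n : ℝ) ^ 2 / l ^ 2)) =
        (2⁻¹ ^ 7 * (ε * n / l)) * (ε * n / (16 * l)) := by field_simp; norm_num
    calc _ ≤ 2 * ((2 : ℝ)⁻¹ ^ 12 * ε ^ 2 * ((n : ℝ) ^ 2 / l ^ 2)) := by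
          have := hedge T
          gcongr
      _ ≤ (2⁻¹ ^ 7 * (ε * n / l)) * T.card := by rw [h1]; gcongr
      _ < _ := by
          have : (0 : ℝ) < T.card := by exact_mod_cast Finset.card_pos.2 hT
          gcongr
          norm_num
  · have : (0 : ℝ) < S.card := hs₀.trans hS
    rw [div_mul_cancel₀ _ (by positivity), ha]
    have := hedge S
    gcongr
  · have hs' : 0 < s' := hs₀.trans_le h1
    have hs : 0 < s := hs'.trans_le h2
    have : -(a / s) - -(a / s') = (s - s') * (a / (s * s')) := by field_simp; ring
    rw [this]
    refine mul_le_mul_of_nonneg_left ?_ (by linarith)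
    rw [sq]
    gcongr
  · have h1 : (-(a / n) - -(a / (ε * n / (16 * L)))) / k ≤ a / (ε * n / (16 * L)) / k := by
      have : 0 ≤ a / n := by positivity
      gcongr
      linarith
    refine h1.trans ?_
    have h2 : a / (ε * n / (16 * L)) / k = 1 / 8 * (ε * n / l) * (L / l) := by
      rw [ha]; field_simp; norm_num
    -- From `log n ≤ 3pl` and `p ≤ 1/2`.
    have h3 : L / l ≤ 3 / 2 := by
      rw [div_le_iff₀ hl]
      nlinarith
    rw [h2]
    calc _ ≤ 1 / 8 * (ε * n / l) * (3 / 2) := by gcongr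
      _ = _ := by ring

/-- Bounded degree makes `e_H(S)` linear in `|S|`, so `D(s)` is proportional to `1/s` and the
potential is logarithmic. As `s₀` is below `n` only by the factor `16 log n/ε`, the cost is of order
`d log log n`. -/
theorem ResilienceParams.locallyResilient (h : ResilienceParams ε p l n k) (hε : 0 < ε)
    (hl : l = logbNP n p)
    (hA : IsTypical p (ε * n / (16 * Real.log n)) (ε * n / (16 * l)) k A) :
    LocallyResilient ε n p (SimpleGraph.fromEdgeSet (A : Set (Sym2 (Fin n)))) := by
  classical
  intro H hHd
  rw [chiBound]
  rw [← hl] at hHd ⊢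
  have h' := h
  obtain ⟨hp0, hp, hl, hLl, hpl, hk2, hkl, hU, hL1, hL2, hLL⟩ := h
  have hn : (0 : ℝ) < n := by
    rcases (Nat.cast_nonneg (α := ℝ) n).eq_or_lt with h | h
    · rw [← h] at hU; norm_num at hU
    · exact h
  have hL : 0 < Real.log n := by linarith
  have hk : (0 : ℝ) < k := by exact_mod_cast (by omega : 0 < k)
  set L := Real.log n
  have hLL0 : 0 < Real.log L := by linarith
  set d := (2 : ℝ)⁻¹ ^ 8 * ε * ((n : ℝ) / (l * Real.log L)) with hd
  have hd0 : 0 ≤ d := by positivity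
  have hd1 : d = 2⁻¹ ^ 8 * (ε * n / l) / Real.log L := by rw [hd]; field_simp
  have hedge : ∀ T : Finset (Fin n), 2 * (edgesIn H T : ℝ) ≤ T.card * d := by
    intro T
    refine two_mul_edgesIn_le_of_degree_le fun v _ => le_trans ?_ hHd
    have h1 : degreeIn H T v ≤ H.degree v := by
      rw [← SimpleGraph.card_neighborFinset_eq_degree]
      refine Finset.card_le_card fun u hu => ?_
      rw [SimpleGraph.mem_neighborFinset]
      exact (Finset.mem_filter.1 hu).2
    have h2 := h1.trans (H.degree_le_maxDegree v)
    have h3 : (degreeIn H T v : ℝ) ≤ H.maxDegree := by exact_mod_cast h2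
    convert h3
  have hs₀ : 0 < ε * n / (16 * L) := by positivity
  refine h'.chi_le hε hA _ (fun T hT hTc => ?_) (D := fun s => 16 * k * d / s)
    (φ := fun s => 16 * k * d * Real.log s)
    (fun S hS => ?_) (fun s hs => ?_) (fun s' s h1 h2 => ?_) ?_
  · have : (0 : ℝ) < T.card := by exact_mod_cast Finset.card_pos.2 hT
    refine (hedge T).trans_lt ?_
    rw [mul_comm]
    gcongr
    rw [hd1, div_lt_iff₀ hLL0]
    have : 0 < ε * n / l := by positivity
    calc 2⁻¹ ^ 8 * (ε * n / l) < 2 / 100 * (ε * n / l) := by gcongr; norm_num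
      _ ≤ _ := le_mul_of_one_le_right (by positivity) hLL
  · have hSc : (0 : ℝ) < S.card := hs₀.trans hS
    have h1 : 16 * k * d / S.card * (S.card : ℝ) ^ 2 = 16 * k * (S.card * d) := by
      field_simp
    rw [h1]
    have := mul_le_mul_of_nonneg_left (hedge S) (by positivity : (0 : ℝ) ≤ 16 * k)
    linarith
  · have : 0 < s := hs₀.trans_le hs
    positivity
  · have hs' : 0 < s' := hs₀.trans_le h1
    have hs : 0 < s := hs'.trans_le h2
    rw [← mul_sub]
    have h3 : (s - s') / s ≤ Real.log s - Real.log s' := by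
      have := Real.log_le_sub_one_of_pos (div_pos hs' hs)
      rw [Real.log_div hs'.ne' hs.ne'] at this
      rw [sub_div, div_self hs.ne']
      linarith
    calc _ = 16 * k * d * ((s - s') / s) := by ring
      _ ≤ _ := by gcongr
  -- `n/s₀ = (16/ε) log n ≤ (log n)²`, since `log n > 16/ε`.
  · have h1 : Real.log n - Real.log (ε * n / (16 * L)) ≤ 2 * Real.log L := by
      rw [← Real.log_div hn.ne' hs₀.ne']
      have e1 : (n : ℝ) / (ε * n / (16 * L)) = 16 / ε * L := by field_simp
      rw [e1, two_mul, Real.log_mul (by positivity) hL.ne']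
      gcongr
    have h2 : (16 * k * d * Real.log n - 16 * k * d * Real.log (ε * n / (16 * L))) / k =
        16 * d * (Real.log n - Real.log (ε * n / (16 * L))) := by field_simp
    rw [h2]
    calc _ ≤ 16 * d * (2 * Real.log L) := by gcongr
      _ = 1 / 8 * (ε * n / l) := by rw [hd1]; field_simp; norm_num
      _ ≤ _ := by
        have : 0 ≤ ε * n / l := by positivity
        linarith

end Resilience

/-! ### Estimating the overlap sum -/

theorem two_mul_choose_two_sub_one (i : ℕ) : 2 * ((i + 2).choose 2 - 1) = i * (i + 3) := by
  have h := Nat.choose_two_right (i + 2)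
  have h2 : (i + 2) * (i + 2 - 1) = i * (i + 3) + 2 := by
    rw [show i + 2 - 1 = i + 1 by omega]; ring
  have h3 : Even ((i + 2) * (i + 2 - 1)) := Nat.even_mul_pred_self (i + 2)
  obtain ⟨m, hm⟩ := h3
  omega

/-- With `γ = √(1/(1-p))` the `i`-th term is at most `C(k,i)(4kγ^i/s)^i`, and four ranges of `i` are
treated separately. For `i = 1` the difference `β² - 1` saves a factor `p`. For `2 ≤ i < m` the
power of `γ` is bounded by a constant and the square of `w` suffices. For `m ≤ i ≤ k/2` one has `γ^i
≤ √z`, so `C(k,i) ≤ k^i` is affordable. For `i > k/2` only `γ^i ≤ z` is available, but there `C(k,i)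
≤ 4^i` saves a factor of order `k`. -/
theorem overlapBound_le {p z w θ : ℝ} {s k m : ℕ} (hp0 : 0 ≤ p) (hp : p ≤ 1 / 2) (hs : 0 < s)
    (hz : √(1 / (1 - p)) ^ k ≤ z)
    (hw : 4 * 2 ^ m * (k : ℝ) ^ 2 / s ≤ w) (hw1 : w ≤ 1) (hθ : 0 ≤ θ)
    (hv1 : 4 * (k : ℝ) ^ 2 * √z / s ≤ 1) (hv : (4 * (k : ℝ) ^ 2 * √z / s) ^ m ≤ θ)
    (hu : ∀ i, k < 2 * i → (16 * k * z / s) ^ i ≤ θ) :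
    overlapBound (1 / (1 - p)) s k ≤ 8 * p * (k : ℝ) ^ 2 / s + m * w ^ 2 + k * θ := by
  have hq : 0 < 1 - p := by linarith
  set β := 1 / (1 - p) with hβdef
  have hβ1 : 1 ≤ β := by rw [hβdef, le_div_iff₀ hq]; linarith
  have hβ2 : β ≤ 2 := by rw [hβdef, div_le_iff₀ hq]; linarith
  set γ := √β with hγdef
  have hγsq : γ ^ 2 = β := Real.sq_sqrt (by linarith)
  have hγ1 : 1 ≤ γ := Real.one_le_sqrt.2 hβ1
  have hγ2 : γ ≤ 2 := by nlinarith
  have hγ3 : γ ^ 3 ≤ 4 := by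
    calc γ ^ 3 = γ ^ 2 * γ := by ring
      _ ≤ 2 * 2 := by rw [hγsq]; gcongr
      _ = 4 := by norm_num
  have hs' : (0 : ℝ) < s := by exact_mod_cast hs
  have hz0 : 0 ≤ z := le_trans (by positivity) hz
  have hw0 : 0 ≤ w := le_trans (by positivity) hw
  have hterm : ∀ i, (k.choose i : ℝ) * ((k : ℝ) / s) ^ i * (β ^ ((i + 2).choose 2 - 1) - 1) ≤
      (k.choose i : ℝ) * (4 * k * γ ^ i / s) ^ i := by
    intro i
    have h1 : β ^ ((i + 2).choose 2 - 1) = (γ ^ (i + 3)) ^ i := by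
      rw [← hγsq, ← pow_mul, two_mul_choose_two_sub_one, ← pow_mul, mul_comm]
    have h2 : (γ ^ (i + 3)) ^ i ≤ (4 * γ ^ i) ^ i := by
      rw [pow_add, mul_comm]
      gcongr
    calc _ ≤ (k.choose i : ℝ) * ((k : ℝ) / s) ^ i * (4 * γ ^ i) ^ i := by
          gcongr
          linarith
      _ = _ := by rw [mul_assoc, ← mul_pow]; congr 2; ring
  have hpow : ∀ i, (k.choose i : ℝ) * (4 * k * γ ^ i / s) ^ i ≤
      (4 * (k : ℝ) ^ 2 * γ ^ i / s) ^ i := by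
    intro i
    have : (k.choose i : ℝ) ≤ (k : ℝ) ^ i := by exact_mod_cast Nat.choose_le_pow k i
    calc _ ≤ (k : ℝ) ^ i * (4 * k * γ ^ i / s) ^ i := by gcongr
      _ = _ := by rw [← mul_pow]; congr 1; ring
  have hmain : ∀ i ∈ Finset.Icc 1 k,
      (k.choose i : ℝ) * ((k : ℝ) / s) ^ i * (β ^ ((i + 2).choose 2 - 1) - 1) ≤
      (if i = 1 then 8 * p * (k : ℝ) ^ 2 / s else 0) + (if i < m then w ^ 2 else 0) + θ := by
    intro i hi
    have hi1 := (Finset.mem_Icc.1 hi).1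
    have n1 : 0 ≤ if i = 1 then 8 * p * (k : ℝ) ^ 2 / s else 0 := by
      split_ifs <;> positivity
    have n2 : 0 ≤ if i < m then w ^ 2 else 0 := by
      split_ifs <;> positivity
    by_cases e1 : i = 1
    · have : (k.choose i : ℝ) * ((k : ℝ) / s) ^ i * (β ^ ((i + 2).choose 2 - 1) - 1) ≤
          8 * p * (k : ℝ) ^ 2 / s := by
        subst e1
        have hb : β ^ 2 - 1 ≤ 8 * p := by
          have : β * (1 - p) = 1 := by rw [hβdef]; field_simp
          have h2 : β - 1 = β * p := by linarith
          nlinarith [mul_nonneg hp0 (by linarith : (0 : ℝ) ≤ β)]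
        have hc : (1 + 2).choose 2 - 1 = 2 := by decide
        rw [hc, Nat.choose_one_right, pow_one]
        calc _ ≤ (k : ℝ) * (k / s) * (8 * p) := by gcongr
          _ = _ := by ring
      rw [if_pos e1]
      linarith
    · refine (hterm i).trans ?_
      rw [if_neg e1, zero_add]
      by_cases e2 : i < m
      · rw [if_pos e2]
        have h1 : (4 * (k : ℝ) ^ 2 * γ ^ i / s) ≤ w := by
          refine le_trans ?_ hw
          have : γ ^ i ≤ 2 ^ m := by
            calc γ ^ i ≤ 2 ^ i := by gcongr
              _ ≤ 2 ^ m := pow_le_pow_right₀ (by norm_num) e2.le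
          calc _ ≤ 4 * (k : ℝ) ^ 2 * 2 ^ m / s := by gcongr
            _ = _ := by ring
        have h2 : (4 * (k : ℝ) ^ 2 * γ ^ i / s) ^ i ≤ w ^ 2 := by
          calc _ ≤ w ^ i := by gcongr
            _ ≤ w ^ 2 := pow_le_pow_of_le_one hw0 hw1 (by omega)
        linarith [hpow i]
      · rw [if_neg e2, zero_add]
        by_cases e3 : 2 * i ≤ k
        · have h1 : γ ^ i ≤ √z := by
            refine Real.le_sqrt_of_sq_le ?_
            rw [← pow_mul]
            exact (pow_le_pow_right₀ hγ1 (by omega)).trans hz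
          calc _ ≤ (4 * (k : ℝ) ^ 2 * γ ^ i / s) ^ i := hpow i
            _ ≤ (4 * (k : ℝ) ^ 2 * √z / s) ^ i := by gcongr
            _ ≤ (4 * (k : ℝ) ^ 2 * √z / s) ^ m :=
                pow_le_pow_of_le_one (by positivity) hv1 (by omega)
            _ ≤ θ := hv
        · have h1 : (k.choose i : ℝ) ≤ 4 ^ i := by
            have a1 : (k.choose i : ℝ) ≤ 2 ^ k := by exact_mod_cast Nat.choose_le_two_pow k i
            have a2 : (2 : ℝ) ^ k ≤ 2 ^ (2 * i) := pow_le_pow_right₀ (by norm_num) (by omega)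
            rw [pow_mul] at a2
            norm_num at a2
            linarith
          have h2 : γ ^ i ≤ z := (pow_le_pow_right₀ hγ1 (Finset.mem_Icc.1 hi).2).trans hz
          calc _ ≤ 4 ^ i * (4 * k * z / s) ^ i := by gcongr
            _ = (16 * k * z / s) ^ i := by rw [← mul_pow]; congr 1; ring
            _ ≤ θ := hu i (by omega)
  refine (Finset.sum_le_sum hmain).trans ?_
  rw [Finset.sum_add_distrib, Finset.sum_add_distrib]
  refine add_le_add (add_le_add ?_ ?_) ?_
  · rw [Finset.sum_ite_eq']
    split_ifs
    · exact le_rfl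
    · positivity
  · rw [← Finset.sum_filter, Finset.sum_const, nsmul_eq_mul]
    have : ((Finset.Icc 1 k).filter fun i => i < m).card ≤ m := by
      calc _ ≤ (Finset.range m).card := Finset.card_le_card fun i hi => by
            simp only [Finset.mem_filter, Finset.mem_range] at hi ⊢
            exact hi.2
        _ = m := Finset.card_range m
    gcongr
  · rw [Finset.sum_const, nsmul_eq_mul, Nat.card_Icc]
    simp

theorem eventually_mul_log_pow_le_rpow (C : ℝ) (a : ℕ) {c : ℝ} (hc : 0 < c) :
    ∀ᶠ n : ℕ in atTop, C * Real.log n ^ a ≤ (n : ℝ) ^ c := by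
  have h := (isLittleO_log_rpow_rpow_atTop (a : ℝ) hc).const_mul_left C
  have h2 := h.bound (zero_lt_one)
  have h3 := tendsto_natCast_atTop_atTop (R := ℝ) |>.eventually h2
  filter_upwards [h3] with n hn
  rw [one_mul, Real.rpow_natCast, Real.norm_of_nonneg (by positivity : (0:ℝ) ≤ (n : ℝ) ^ c)] at hn
  exact (le_abs_self _).trans hn

/-! ### Numerical estimates -/

section Numerics

/-- Up to logarithms `k` is `1/p` and `s` is `x`, so the ratio is of order `√(xp)/(p²x) = 1/√(p³x)`.
-/
theorem ratio_middle_le {ε δ p x L z : ℝ} {s k : ℕ} (hε : 0 < ε) (hp0 : 0 < p) (hx0 : 0 < x)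
    (hL0 : 0 < L) (hk2s : (k : ℝ) ^ 2 / s ≤ 64 * L ^ 3 / (ε * (p ^ 2 * x)))
    (hzle : z ≤ x * p) (hg : x ^ (3 * δ) ≤ p ^ 3 * x) (c4 : (256 / ε) ^ 2 * L ^ 6 ≤ x ^ δ) :
    4 * (k : ℝ) ^ 2 * √z / s ≤ x ^ (-δ) := by
  set g := p ^ 3 * x with hgdef
  have hg0 : 0 < g := by positivity
  have e1 : √(x * p) * √g = p ^ 2 * x := by
    rw [← Real.sqrt_mul (by positivity), Real.sqrt_eq_iff_mul_self_eq (by positivity)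
      (by positivity), hgdef]
    ring
  have e2 : 256 / ε * L ^ 3 * x ^ δ ≤ √g := by
    refine Real.le_sqrt_of_sq_le (le_trans ?_ hg)
    calc (256 / ε * L ^ 3 * x ^ δ) ^ 2 = (256 / ε) ^ 2 * L ^ 6 * (x ^ δ) ^ 2 := by ring
      _ ≤ x ^ δ * (x ^ δ) ^ 2 := by gcongr
      _ = x ^ (3 * δ) := by
          rw [← pow_succ', ← Real.rpow_natCast, ← Real.rpow_mul hx0.le]
          norm_num [mul_comm]
  have hsg : 0 < √g := Real.sqrt_pos.2 hg0
  calc 4 * (k : ℝ) ^ 2 * √z / s = 4 * (k ^ 2 / s) * √z := by ring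
    _ ≤ 4 * (64 * L ^ 3 / (ε * (p ^ 2 * x))) * √(x * p) := by gcongr
    _ = 256 / ε * L ^ 3 / √g := by
        rw [← e1]
        have : 0 < √(x * p) := Real.sqrt_pos.2 (by positivity)
        field_simp
        norm_num
    _ ≤ x ^ (-δ) := by
        rw [Real.rpow_neg hx0.le, div_le_iff₀ hsg, ← div_eq_inv_mul,
          le_div_iff₀ (by positivity)]
        exact e2

/-- Up to logarithms `kz/s` is `(xp)^(-η)`: the gain comes entirely from taking `k` below `2
log_b(np)` by a factor `1 - η`. -/
theorem ratio_top_le {ε η p x L : ℝ} {s k : ℕ} (hε : 0 < ε) (hη : 0 < η) (hp0 : 0 < p)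
    (hx0 : 0 < x) (hL0 : 0 < L) (hinv : 1 / (s : ℝ) ≤ 16 * L / (ε * x))
    (hk : (k : ℝ) ≤ 2 * L / p) (hxp : x ^ (2 / 3 : ℝ) ≤ x * p)
    (c5 : 512 / ε * L ^ 2 ≤ x ^ (η / 6)) :
    16 * (k : ℝ) * (x * p) ^ (1 - η) / s ≤ x ^ (-(η / 2)) := by
  set z := (x * p) ^ (1 - η) with hzdef
  have hz0 : 0 ≤ z := by positivity
  have e1 : z = x * p * (x * p) ^ (-η) := by
    rw [hzdef, sub_eq_add_neg, Real.rpow_add (by positivity), Real.rpow_one]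
  have e2 : (x * p) ^ (-η) ≤ x ^ (-(2 / 3 * η)) := by
    calc (x * p) ^ (-η) ≤ (x ^ (2 / 3 : ℝ)) ^ (-η) :=
          Real.rpow_le_rpow_of_nonpos (by positivity) hxp (by linarith)
      _ = _ := by rw [← Real.rpow_mul hx0.le]; ring_nf
  calc 16 * (k : ℝ) * z / s = 16 * k * z * (1 / s) := by ring
    _ ≤ 16 * (2 * L / p) * z * (16 * L / (ε * x)) := by gcongr
    _ = 512 / ε * L ^ 2 * (x * p) ^ (-η) := by rw [e1]; field_simp; norm_num
    _ ≤ x ^ (η / 6) * x ^ (-(2 / 3 * η)) := by gcongr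
    _ = _ := by rw [← Real.rpow_add hx0]; ring_nf

theorem first_term_le {ε p x L : ℝ} {k s : ℕ} (hε : 0 < ε) (hp0 : 0 < p) (hx0 : 0 < x)
    (hL0 : 0 < L)
    (hk2 : (k : ℝ) ^ 2 ≤ 4 * L ^ 2 / p ^ 2)
    (hk2s : (k : ℝ) ^ 2 / s ≤ 64 * L ^ 3 / (ε * (p ^ 2 * x)))
    (c3 : 16384 * L ^ 5 / ε ≤ p ^ 3 * x) :
    2 * (k : ℝ) ^ 2 * (8 * p * (k : ℝ) ^ 2 / s) ≤ 1 / 4 := by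
  set g := p ^ 3 * x with hgdef
  have hg0 : 0 < g := by positivity
  calc 2 * (k : ℝ) ^ 2 * (8 * p * (k : ℝ) ^ 2 / s) = 16 * p * k ^ 2 * (k ^ 2 / s) := by ring
    _ ≤ 16 * p * (4 * L ^ 2 / p ^ 2) * (64 * L ^ 3 / (ε * (p ^ 2 * x))) := by gcongr
    _ = 1 / 4 * (16384 * L ^ 5 / ε / g) := by rw [hgdef]; field_simp; norm_num
    _ ≤ 1 / 4 * 1 := by
        gcongr
        exact div_le_one_of_le₀ c3 hg0.le
    _ = 1 / 4 := by norm_num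

theorem second_term_le {ε p x L : ℝ} {k m : ℕ} (hε : 0 < ε) (hp0 : 0 < p) (hx0 : 0 < x)
    (hL0 : 0 < L)
    (hk2 : (k : ℝ) ^ 2 ≤ 4 * L ^ 2 / p ^ 2)
    (hg1 : 1 ≤ p ^ 3 * x) (c2 : 4 * m * 2 ^ (2 * m + 19) * L ^ 8 / ε ^ 2 ≤ p ^ 3 * x) :
    2 * (k : ℝ) ^ 2 * (m * (2 ^ (m + 8) * L ^ 3 / (ε * (p ^ 2 * x))) ^ 2) ≤ 1 / 4 := by
  set g := p ^ 3 * x with hgdef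
  have hg0 : 0 < g := by positivity
  calc _ ≤ 2 * (4 * L ^ 2 / p ^ 2) *
        (m * (2 ^ (m + 8) * L ^ 3 / (ε * (p ^ 2 * x))) ^ 2) := by gcongr
    _ = 1 / 4 * (4 * m * 2 ^ (2 * m + 19) * L ^ 8 / ε ^ 2 / g ^ 2) := by
        rw [hgdef, show 2 * m + 19 = m + m + 19 by ring, pow_add, pow_add, pow_add]
        field_simp; norm_num
    _ ≤ 1 / 4 * 1 := by
        gcongr
        refine div_le_one_of_le₀ (c2.trans ?_) (by positivity)
        nlinarith
    _ = 1 / 4 := by norm_num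

theorem third_term_le {p x L : ℝ} {k : ℕ} (hp0 : 0 < p) (hx0 : 0 < x)
    (hL0 : 0 < L)
    (hx : 1 ≤ x) (hk : (k : ℝ) ≤ 2 * L / p) (c6 : 64 * L ^ 3 ≤ p ^ 3 * x) :
    2 * (k : ℝ) ^ 2 * (k * x ^ (-3 : ℝ)) ≤ 1 / 4 := by
  set g := p ^ 3 * x with hgdef
  have hg0 : 0 < g := by positivity
  have hx3 : x ^ (-3 : ℝ) = 1 / x ^ 3 := by
    rw [Real.rpow_neg hx0.le, one_div]
    norm_cast
  rw [hx3]
  calc 2 * (k : ℝ) ^ 2 * (k * (1 / x ^ 3)) = 2 * k ^ 3 * (1 / x ^ 3) := by ring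
    _ ≤ 2 * (2 * L / p) ^ 3 * (1 / x ^ 3) := by gcongr
    _ = 1 / 4 * (64 * L ^ 3 / (g * x ^ 2)) := by rw [hgdef]; field_simp; norm_num
    _ ≤ 1 / 4 * 1 := by
        gcongr
        refine div_le_one_of_le₀ (c6.trans ?_) (by positivity)
        exact le_mul_of_one_le_right hg0.le (one_le_pow₀ hx)
    _ = 1 / 4 := by norm_num

/-- The relative variance is small for `k` below `2 log_b (np)` and `s` at least of order
`n / log n`. -/
theorem two_mul_sq_mul_overlapBound_le {ε δ η p x L : ℝ} {s k m : ℕ} (hε : 0 < ε)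
    (hη : 0 < η) (hp0 : 0 < p) (hp : p ≤ 1 / 2) (hx : 1 ≤ x) (hL : 1 ≤ L)
    (hs : ε * x / (16 * L) ≤ s) (hk : (k : ℝ) ≤ 2 * L / p)
    (hz : √(1 / (1 - p)) ^ k ≤ (x * p) ^ (1 - η)) (hxp : x ^ (2 / 3 : ℝ) ≤ x * p)
    (hδm : 3 ≤ δ * m) (hηk : 12 / η ≤ k) (hg : x ^ (3 * δ) ≤ p ^ 3 * x)
    (c1 : 2 ^ (m + 8) * L ^ 3 / ε ≤ p ^ 3 * x)
    (c2 : 4 * m * 2 ^ (2 * m + 19) * L ^ 8 / ε ^ 2 ≤ p ^ 3 * x)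
    (c3 : 16384 * L ^ 5 / ε ≤ p ^ 3 * x)
    (c4 : (256 / ε) ^ 2 * L ^ 6 ≤ x ^ δ)
    (c5 : 512 / ε * L ^ 2 ≤ x ^ (η / 6))
    (c6 : 64 * L ^ 3 ≤ p ^ 3 * x) :
    2 * (k : ℝ) ^ 2 * overlapBound (1 / (1 - p)) s k ≤ 1 := by
  have hx0 : 0 < x := by linarith
  have hL0 : 0 < L := by linarith
  have hs₀ : 0 < ε * x / (16 * L) := by positivity
  have hs0 : (0 : ℝ) < s := hs₀.trans_le hs
  set g := p ^ 3 * x with hgdef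
  have hg0 : 0 < g := by positivity
  have hg1 : 1 ≤ g := by
    have : (1 : ℝ) ≤ L ^ 3 := one_le_pow₀ hL
    linarith
  have hp1 : p ≤ 1 := by linarith
  have hgp2 : g ≤ p ^ 2 * x := by
    rw [hgdef]
    have : p ^ 3 ≤ p ^ 2 := pow_le_pow_of_le_one hp0.le hp1 (by norm_num)
    gcongr
  have hxp1 : 1 ≤ x * p := (Real.one_le_rpow hx (by norm_num)).trans hxp
  have hinv : 1 / (s : ℝ) ≤ 16 * L / (ε * x) := by
    rw [div_le_iff₀ hs0, div_mul_eq_mul_div, le_div_iff₀ (by positivity)]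
    rw [div_le_iff₀ (by positivity)] at hs
    linarith
  have hk2 : (k : ℝ) ^ 2 ≤ 4 * L ^ 2 / p ^ 2 := by
    calc (k : ℝ) ^ 2 ≤ (2 * L / p) ^ 2 := by gcongr
      _ = _ := by rw [div_pow]; ring
  have hk2s : (k : ℝ) ^ 2 / s ≤ 64 * L ^ 3 / (ε * (p ^ 2 * x)) := by
    calc (k : ℝ) ^ 2 / s = k ^ 2 * (1 / s) := by ring
      _ ≤ 4 * L ^ 2 / p ^ 2 * (16 * L / (ε * x)) := by gcongr
      _ = _ := by field_simp; norm_num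
  set z := (x * p) ^ (1 - η) with hzdef
  have hz0 : 0 ≤ z := by positivity
  have hzle : z ≤ x * p := by
    calc z ≤ (x * p) ^ (1 : ℝ) := Real.rpow_le_rpow_of_exponent_le hxp1 (by linarith)
      _ = x * p := Real.rpow_one _
  have hv := ratio_middle_le hε hp0 hx0 hL0 hk2s hzle hg c4
  have hδ0 : 0 ≤ δ := by
    by_contra h
    push Not at h
    nlinarith [Nat.cast_nonneg (α := ℝ) m]
  have hu := ratio_top_le (k := k) hε hη hp0 hx0 hL0 hinv hk hxp c5
  -- The target `θ = x^(-3)` beats the prefactor `k³` from `2k² · k`. It is reached in the middle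
  -- range because `δm ≥ 3`, and in the top range because `i > k/2 ≥ 6/η`.
  have hR := overlapBound_le (z := z) (w := 2 ^ (m + 8) * L ^ 3 / (ε * (p ^ 2 * x)))
    (θ := x ^ (-3 : ℝ)) (s := s) (k := k) (m := m) hp0.le hp (by exact_mod_cast hs0) hz ?_ ?_
    (by positivity) (hv.trans (Real.rpow_le_one_of_one_le_of_nonpos hx (by linarith))) ?_ ?_
  · set R := overlapBound (1 / (1 - p)) s k
    have t1 := first_term_le hε hp0 hx0 hL0 hk2 hk2s c3
    have t2 := second_term_le (k := k) (m := m) hε hp0 hx0 hL0 hk2 hg1 c2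
    have t3 := third_term_le (k := k) hp0 hx0 hL0 hx hk c6
    calc 2 * (k : ℝ) ^ 2 * R ≤ 2 * (k : ℝ) ^ 2 * (8 * p * (k : ℝ) ^ 2 / s +
          m * (2 ^ (m + 8) * L ^ 3 / (ε * (p ^ 2 * x))) ^ 2 + k * x ^ (-3 : ℝ)) := by gcongr
      _ ≤ 1 := by rw [mul_add, mul_add]; linarith
  · calc 4 * 2 ^ m * (k : ℝ) ^ 2 / s = 4 * 2 ^ m * (k ^ 2 / s) := by ring
      _ ≤ 4 * 2 ^ m * (64 * L ^ 3 / (ε * (p ^ 2 * x))) := by gcongr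
      _ = _ := by rw [pow_add]; field_simp; norm_num
  · rw [← div_div]
    exact div_le_one_of_le₀ (c1.trans hgp2) (by positivity)
  · calc _ ≤ (x ^ (-δ)) ^ m := by gcongr
      _ = x ^ (-(δ * m)) := by rw [← Real.rpow_natCast, ← Real.rpow_mul hx0.le, neg_mul]
      _ ≤ _ := Real.rpow_le_rpow_of_exponent_le hx (by linarith)
  · intro i hi
    have hi' : (k : ℝ) < 2 * i := by exact_mod_cast hi
    have h6 : 6 ≤ η * i := by
      have := (div_le_iff₀ hη).1 (hηk.trans hi'.le)
      linarith
    calc _ ≤ (x ^ (-(η / 2))) ^ i := by gcongr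
      _ = x ^ (-(η / 2) * i) := by rw [← Real.rpow_natCast, ← Real.rpow_mul hx0.le]
      _ ≤ _ := Real.rpow_le_rpow_of_exponent_le hx (by linarith)

theorem log_one_div_one_sub_bounds {p : ℝ} (hp0 : 0 < p) (hp : p ≤ 1 / 2) :
    p ≤ Real.log (1 / (1 - p)) ∧ Real.log (1 / (1 - p)) ≤ 2 * p := by
  have hq : 0 < 1 - p := by linarith
  constructor
  · rw [one_div, Real.log_inv]
    linarith [Real.log_le_sub_one_of_pos hq]
  · refine (Real.log_le_sub_one_of_pos (by positivity)).trans ?_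
    rw [sub_le_iff_le_add, div_le_iff₀ hq]
    nlinarith

/-- Since `log(1/(1-p))` lies between `p` and `2p`, and `log(xp)` between `(2/3) log x` and `log x`,
the quantity `log_b(xp)` has order `(log x)/p`. -/
theorem logb_bounds {p x : ℝ} (hp0 : 0 < p) (hp : p ≤ 1 / 2) (hx : 1 < x)
    (hxp : x ^ (2 / 3 : ℝ) ≤ x * p) :
    0 < Real.logb (1 / (1 - p)) (x * p) ∧
      Real.log x ≤ 3 * p * Real.logb (1 / (1 - p)) (x * p) ∧
      p * Real.logb (1 / (1 - p)) (x * p) ≤ Real.log x ∧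
      2 / 3 * Real.log x ≤ Real.logb (1 / (1 - p)) (x * p) := by
  have hx0 : 0 < x := by linarith
  have hL0 : 0 < Real.log x := Real.log_pos hx
  have hlog1 : 2 / 3 * Real.log x ≤ Real.log (x * p) := by
    rw [← Real.log_rpow hx0]
    exact Real.log_le_log (by positivity) hxp
  have hlog2 : Real.log (x * p) ≤ Real.log x :=
    Real.log_le_log (by positivity) (mul_le_of_le_one_right hx0.le (by linarith))
  obtain ⟨hb1, hb2⟩ := log_one_div_one_sub_bounds hp0 hp
  set l := Real.logb (1 / (1 - p)) (x * p) with hl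
  have hll : l * Real.log (1 / (1 - p)) = Real.log (x * p) := by
    rw [hl, Real.logb, div_mul_cancel₀ _ (by linarith)]
  have hl0 : 0 < l := div_pos (by linarith) (by linarith)
  have h1 := mul_le_mul_of_nonneg_left hb1 hl0.le
  have h2 := mul_le_mul_of_nonneg_left hb2 hl0.le
  have h3 := mul_le_mul_of_nonneg_left hp hl0.le
  exact ⟨hl0, by linarith, by linarith, by linarith⟩

/-- The size of the independent sets: slightly less than `2 log_b (np)`. -/
theorem exists_independent_set_size {ε η p l y : ℝ} (hε : 0 < ε) (hη : 0 < η)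
    (hη1 : 16 * η ≤ 1) (hηε : 16 * η ≤ ε) (hp0 : 0 < p) (hp : p ≤ 1 / 2) (hy : 1 < y)
    (hl : l = Real.logb (1 / (1 - p)) y) (hl2 : 2 ≤ l) (hlη : 1 + ε / 4 ≤ 4 * η * l)
    (hlη' : 12 / η ≤ l) :
    ∃ k : ℕ, l ≤ k ∧ (k : ℝ) ≤ 2 * l ∧ 2 ≤ k ∧ 1 / (k : ℝ) ≤ (1 + ε / 4) / (2 * l) ∧
      12 / η ≤ k ∧ √(1 / (1 - p)) ^ k ≤ y ^ (1 - η) := by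
  have hq : 0 < 1 - p := by linarith
  have hl0 : 0 < l := by linarith
  -- The choice `k = ⌊(2-2η)l⌋` gives `√b^k ≤ b^((1-η)l) = y^(1-η)`. Rounding costs at most 1, which
  -- is absorbed by `1 + ε/4 ≤ 4ηl`.
  have hk1 : (⌊(2 - 2 * η) * l⌋₊ : ℝ) ≤ (2 - 2 * η) * l :=
    Nat.floor_le (mul_nonneg (by linarith) hl0.le)
  have hk2 : (2 - 2 * η) * l - 1 < ⌊(2 - 2 * η) * l⌋₊ := Nat.sub_one_lt_floor _
  set k := ⌊(2 - 2 * η) * l⌋₊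
  have hlk : l ≤ k := by nlinarith
  refine ⟨k, hlk, by nlinarith, by exact_mod_cast hl2.trans hlk, ?_, hlη'.trans hlk, ?_⟩
  · rw [div_le_div_iff₀ (by linarith) (by linarith), one_mul]
    have h1 : (1 + ε / 4) * ((2 - 2 * η) * l - 1) ≤ (1 + ε / 4) * k := by gcongr
    nlinarith
  · have hb := (log_one_div_one_sub_bounds hp0 hp).1
    have hβ0 : 0 < 1 / (1 - p) := by positivity
    have hll : l * Real.log (1 / (1 - p)) = Real.log y := by
      rw [hl, Real.logb, div_mul_cancel₀ _ (by linarith)]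
    have hγ : 0 < √(1 / (1 - p)) := Real.sqrt_pos.2 hβ0
    rw [← Real.log_le_log_iff (by positivity) (by positivity), Real.log_pow,
      Real.log_rpow (by linarith), Real.log_sqrt hβ0.le, ← hll]
    have : (k : ℝ) * Real.log (1 / (1 - p)) ≤ (2 - 2 * η) * l * Real.log (1 / (1 - p)) := by
      gcongr
      linarith
    linarith

theorem sq_div_le {ε P x L l : ℝ} {k : ℕ} (hL1 : 1 ≤ L) (hLε : ε ≤ L) (hP0 : 0 < P)
    (hx0 : 0 ≤ x) (hε : 0 ≤ ε) (hLl : L ≤ 3 * P * l) (hlk : l ≤ k) (hk2 : 2 ≤ k) :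
    (ε * x / (16 * L)) ^ 2 / (16 * (k : ℝ) ^ 2) ≤ P * x ^ 2 := by
  have h1 : ε * x / (16 * L) ≤ x := by
    rw [div_le_iff₀ (by positivity), mul_comm]
    exact mul_le_mul_of_nonneg_left (by linarith) hx0
  rw [div_le_iff₀ (by positivity)]
  have h2 : 1 ≤ P * (16 * (k : ℝ) ^ 2) := by
    have a1 : L ≤ 3 * (P * k) := by
      have := mul_le_mul_of_nonneg_left hlk hP0.le
      linarith
    have a2 : (2 : ℝ) ≤ k := by exact_mod_cast hk2
    have a3 : P * k * 2 ≤ P * k * k := by gcongr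
    linarith
  calc (ε * x / (16 * L)) ^ 2 ≤ x ^ 2 := by gcongr
    _ ≤ x ^ 2 * (P * (16 * (k : ℝ) ^ 2)) := le_mul_of_one_le_right (by positivity) h2
    _ = _ := by ring

/-- With `k` of order `(log n)/p` the right side is `x⁴P⁴` up to logarithms, so the concentration
requirement is again that `P³x` beats a power of the logarithm. -/
theorem four_mul_cube_le {ε P x L : ℝ} {k : ℕ} (hε : 0 < ε) (hP0 : 0 < P) (hx0 : 0 < x)
    (hL0 : 0 < L) (hk0 : (0 : ℝ) < k) (hkP : (k : ℝ) ≤ 2 * L / P)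
    (c8 : 2 ^ 30 / ε ^ 4 * L ^ 8 ≤ P ^ 3 * x) :
    4 * P * x ^ 3 ≤ ((ε * x / (16 * L)) ^ 2 / (16 * (k : ℝ) ^ 2)) ^ 2 := by
  have h1 : ε ^ 2 * x ^ 2 * P ^ 2 / (2 ^ 14 * L ^ 4) ≤
      (ε * x / (16 * L)) ^ 2 / (16 * (k : ℝ) ^ 2) := by
    calc _ = (ε * x / (16 * L)) ^ 2 / (16 * (2 * L / P) ^ 2) := by field_simp; norm_num
      _ ≤ _ := by gcongr
  calc 4 * P * x ^ 3 ≤ (ε ^ 2 * x ^ 2 * P ^ 2 / (2 ^ 14 * L ^ 4)) ^ 2 := by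
        rw [div_pow, le_div_iff₀ (by positivity)]
        rw [div_mul_eq_mul_div, div_le_iff₀ (by positivity)] at c8
        calc _ = P * x ^ 3 * (2 ^ 30 * L ^ 8) := by ring
          _ ≤ P * x ^ 3 * (P ^ 3 * x * ε ^ 4) := by gcongr
          _ = _ := by ring
    _ ≤ _ := by gcongr

theorem sixteen_mul_le {ε P x L l : ℝ} (hε : 0 < ε) (hP0 : 0 < P) (hx0 : 0 < x) (hL0 : 0 < L)
    (hl0 : 0 < l) (hlP : l ≤ L / P) (c9 : 4096 / ε ^ 2 * L ^ 2 ≤ P ^ 3 * x) :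
    16 * x ≤ P * (ε * x / (16 * l)) ^ 2 := by
  rw [div_mul_eq_mul_div, div_le_iff₀ (by positivity)] at c9
  calc 16 * x ≤ P * (ε * x / (16 * (L / P))) ^ 2 := by
        have : P * (ε * x / (16 * (L / P))) ^ 2 =
            x * (P ^ 3 * x * ε ^ 2) / (256 * L ^ 2) := by field_simp; norm_num
        rw [this, le_div_iff₀ (by positivity)]
        calc _ = x * (4096 * L ^ 2) := by ring
          _ ≤ _ := by gcongr
    _ ≤ _ := by gcongr

end Numerics

/-! ### Conditions valid for all large `n` -/

section Eventually

variable {ε δ : ℝ} {p : ℕ → unitInterval}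

theorem eventually_natCast_pow_le {p : ℕ → unitInterval}
    (hp : ∀ᶠ n : ℕ in atTop, (n : ℝ) ^ (-(1 / 3 : ℝ) + δ) ≤ (p n : ℝ) ∧ (p n : ℝ) ≤ 1 / 2) :
    ∀ᶠ n : ℕ in atTop, (n : ℝ) ^ (3 * δ) ≤ (p n : ℝ) ^ 3 * n := by
  filter_upwards [hp, eventually_gt_atTop 0] with n hn hn0
  have hx : (0 : ℝ) < n := by exact_mod_cast hn0
  calc (n : ℝ) ^ (3 * δ) = ((n : ℝ) ^ (-(1 / 3 : ℝ) + δ)) ^ 3 * n := by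
        rw [← Real.rpow_natCast, ← Real.rpow_mul hx.le]
        nth_rewrite 3 [← Real.rpow_one (n : ℝ)]
        rw [← Real.rpow_add hx]
        congr 1
        push_cast
        ring
    _ ≤ _ := by
        have := hn.1
        gcongr

theorem eventually_mul_log_pow_le (hδ : 0 < δ)
    (hp : ∀ᶠ n : ℕ in atTop, (n : ℝ) ^ (-(1 / 3 : ℝ) + δ) ≤ (p n : ℝ) ∧ (p n : ℝ) ≤ 1 / 2)
    (C : ℝ) (a : ℕ) : ∀ᶠ n : ℕ in atTop, C * Real.log n ^ a ≤ (p n : ℝ) ^ 3 * n := by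
  filter_upwards [eventually_natCast_pow_le hp,
    eventually_mul_log_pow_le_rpow C a (by positivity : 0 < 3 * δ)] with n h1 h2
  exact h2.trans h1

/-- The hypothesis on `p` gives `p³n ≥ n^(3δ)`, which eventually exceeds every fixed multiple of a
power of `log n`; each numerical requirement reduces to this or to a comparison of `log n` with a
small power of `n` or a constant. -/
theorem eventually_exists_params (hε : 0 < ε) (hδ : 0 < δ)
    (hp : ∀ᶠ n : ℕ in atTop, (n : ℝ) ^ (-(1 / 3 : ℝ) + δ) ≤ (p n : ℝ) ∧ (p n : ℝ) ≤ 1 / 2) :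
    ∀ᶠ n : ℕ in atTop, ∃ k : ℕ, ResilienceParams ε (p n) (logbNP n (p n)) n k ∧
      bernoulliExp (p n) (pairs (Finset.univ : Finset (Fin n)))
        (fun A => open Classical in if IsTypical (p n) (ε * n / (16 * Real.log n))
          (ε * n / (16 * logbNP n (p n))) k A then 0 else 1) ≤ 2 * Real.exp (-n) := by
  obtain ⟨η, hη0, hη1, hηε⟩ : ∃ η : ℝ, 0 < η ∧ 16 * η ≤ 1 ∧ 16 * η ≤ ε :=
    ⟨min ε 1 / 16, by positivity, by linarith [min_le_right ε 1], by linarith [min_le_left ε 1]⟩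
  obtain ⟨m, hm⟩ : ∃ m : ℕ, 3 ≤ δ * m := by
    obtain ⟨m, hm⟩ := exists_nat_ge (3 / δ)
    exact ⟨m, by rwa [div_le_iff₀' hδ] at hm⟩
  have hlog : Tendsto (fun n : ℕ => Real.log n) atTop atTop :=
    Real.tendsto_log_atTop.comp tendsto_natCast_atTop_atTop
  have hloglog : Tendsto (fun n : ℕ => Real.log (Real.log n)) atTop atTop :=
    Real.tendsto_log_atTop.comp hlog
  have E := eventually_mul_log_pow_le hδ hp
  filter_upwards [hp, eventually_natCast_pow_le hp, eventually_ge_atTop 2,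
    hlog.eventually_ge_atTop (1 + ε), hlog.eventually_gt_atTop (16 / ε),
    hloglog.eventually_ge_atTop 1,
    hlog.eventually_ge_atTop (3 / 2 * (2 + (1 + ε / 4) / (4 * η) + 12 / η)),
    E (2 ^ (m + 8) / ε) 3, E (4 * m * 2 ^ (2 * m + 19) / ε ^ 2) 8, E (16384 / ε) 5,
    eventually_mul_log_pow_le_rpow ((256 / ε) ^ 2) 6 hδ,
    eventually_mul_log_pow_le_rpow (512 / ε) 2 (by positivity : 0 < η / 6),
    E 64 3, E (32 / ε) 2, E (2 ^ 30 / ε ^ 4) 8, E (4096 / ε ^ 2) 2, E (80 / ε) 1] with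
    n hpn hg hn2 hLε hL16 hLL hLbig c1 c2 c3 c4 c5 c6 c7 c8 c9 c10
  set P : ℝ := (p n : ℝ) with hP
  set x : ℝ := (n : ℝ) with hx
  set L := Real.log x with hLdef
  have hx2 : 2 ≤ x := by rw [hx]; exact_mod_cast hn2
  have hx0 : 0 < x := by linarith only [hx2]
  have hx1 : 1 ≤ x := by linarith only [hx2]
  have hP2 := hpn.2
  have hP0 : 0 < P := lt_of_lt_of_le (by positivity) hpn.1
  have hL1 : 1 ≤ L := by linarith only [hLε, hε]
  have hL0 : 0 < L := by linarith only [hL1]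
  have hxP : x ^ (2 / 3 : ℝ) ≤ x * P := by
    calc x ^ (2 / 3 : ℝ) ≤ x ^ (1 + (-(1 / 3 : ℝ) + δ)) :=
          Real.rpow_le_rpow_of_exponent_le hx1 (by linarith only [hδ])
      _ = x * x ^ (-(1 / 3 : ℝ) + δ) := by rw [Real.rpow_add hx0, Real.rpow_one]
      _ ≤ x * P := by gcongr; exact hpn.1
  have hxP1 : 1 < x * P := (Real.one_lt_rpow (by linarith only [hx2]) (by norm_num)).trans_le hxP
  have hlogb : Real.logb (1 / (1 - P)) (x * P) = logbNP n P := rfl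
  obtain ⟨hl0, hLl, hPl, hlL⟩ := logb_bounds hP0 hP2 (by linarith only [hx2] : 1 < x) hxP
  rw [hlogb] at hl0 hLl hPl hlL
  set l := logbNP n P with hl
  have hlbig : 2 + (1 + ε / 4) / (4 * η) + 12 / η ≤ l := by linarith only [hLbig, hlL]
  have q1 : 0 < (1 + ε / 4) / (4 * η) := by positivity
  have q2 : 0 < 12 / η := by positivity
  obtain ⟨k, hlk, hk2l, hk2, hkinv, hkη, hkz⟩ := exists_independent_set_size hε hη0 hη1 hηε hP0 hP2
    hxP1 (l := l) rfl (by linarith only [hlbig, q1, q2]) (by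
      have : (1 + ε / 4) / (4 * η) ≤ l := by linarith only [hlbig, q1, q2]
      rwa [div_le_iff₀' (by positivity)] at this) (by linarith only [hlbig, q1])
  have hlP : l ≤ L / P := by rw [le_div_iff₀ hP0, mul_comm]; exact hPl
  have hkP : (k : ℝ) ≤ 2 * L / P := by
    calc (k : ℝ) ≤ 2 * l := hk2l
      _ ≤ 2 * (L / P) := by gcongr
      _ = _ := by ring
  have hk0 : (0 : ℝ) < k := hl0.trans_le hlk
  have hP1 : P ≤ 1 := by linarith only [hP2]
  have hgxP : P ^ 3 * x ≤ x * P := by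
    have : P ^ 3 ≤ P := pow_le_of_le_one hP0.le hP1 (by norm_num)
    rw [mul_comm]
    exact mul_le_mul_of_nonneg_left this hx0.le
  refine ⟨k, ⟨hP0, hP2, hl0, hLl, hPl, hk2, hkinv, ?_, hL16, hLε, hLL⟩, ?_⟩
  · rw [le_div_iff₀ (by positivity)]
    have h1 : 80 * L ≤ ε * (x * P) := by
      have := c10.trans hgxP
      rw [pow_one, div_mul_eq_mul_div, div_le_iff₀ hε] at this
      linarith only [this]
    have h3 : 80 * l * P ≤ ε * x * P := by linarith only [h1, hPl]
    have := le_of_mul_le_mul_right h3 hP0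
    linarith only [this]
  · have hgen : ∀ s : ℕ, ε * x / (16 * L) ≤ s →
        2 * (k : ℝ) ^ 2 * overlapBound (1 / (1 - P)) s k ≤ 1 := fun s hs =>
      two_mul_sq_mul_overlapBound_le hε hη0 hP0 hP2 hx1 hL1 hs hkP hkz hxP
        hm hkη hg (by rw [mul_div_right_comm]; exact c1)
        (by rw [mul_div_right_comm]; exact c2) (by rw [mul_div_right_comm]; exact c3) c4 c5 c6
    refine bernoulliExp_not_isTypical_le hP0 hP2 hk2 (by positivity) (by positivity) ?_ hgen ?_ ?_ ?_
    · refine hkP.trans ?_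
      rw [div_le_div_iff₀ hP0 (by positivity)]
      have := c7.trans hgxP
      rw [div_mul_eq_mul_div, div_le_iff₀ hε] at this
      linarith only [this]
    · exact sq_div_le hL1 (by linarith only [hLε]) hP0 hx0.le hε.le hLl hlk hk2
    · exact four_mul_cube_le hε hP0 hx0 hL0 hk0 hkP c8
    · exact sixteen_mul_le hε hP0 hx0 hL0 hl0 hlP c9

end Eventually

/-! ### Conclusion -/

open Classical in
theorem one_sub_le_binomialRandom_real {n : ℕ} (p : unitInterval) (P : SimpleGraph (Fin n) → Prop)
    (T : Finset (Sym2 (Fin n)) → Prop)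
    (h : ∀ A, T A → P (SimpleGraph.fromEdgeSet (A : Set (Sym2 (Fin n))))) :
    1 - bernoulliExp p (pairs Finset.univ) (fun A => if T A then 0 else 1) ≤
      (SimpleGraph.binomialRandom (Fin n) p).real {G | P G} := by
  have h1 := bernoulliExp_const (p := (p : ℝ)) (U := pairs (Finset.univ : Finset (Fin n))) 1
  rw [binomialRandom_real_eq]
  refine le_trans (le_of_eq ?_) (bernoulliExp_mono (f := fun A => 1 - if T A then 0 else 1)
    p.2.1 p.2.2 fun A _ => ?_)
  · rw [bernoulliExp_sub, h1]
  by_cases hA : T A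
  · rw [if_pos hA, if_pos (h A hA)]
    norm_num
  · rw [if_neg hA]
    split_ifs <;> norm_num

theorem theorem6p3 (ε δ : ℝ) (hε : 0 < ε) (hδ : 0 < δ) (p : ℕ → unitInterval)
    (hp : ∀ᶠ n : ℕ in atTop,
      (n : ℝ) ^ (-(1 / 3 : ℝ) + δ) ≤ (p n : ℝ) ∧ (p n : ℝ) ≤ 1 / 2) :
    AAS p (fun n G => GloballyResilient ε n (p n) G ∧ LocallyResilient ε n (p n) G) := by
  set P : (n : ℕ) → SimpleGraph (Fin n) → Prop := fun n G =>
    GloballyResilient ε n (p n) G ∧ LocallyResilient ε n (p n) G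
  have hlow : ∀ᶠ n : ℕ in atTop, 1 - 2 * Real.exp (-(n : ℝ)) ≤
      (SimpleGraph.binomialRandom (Fin n) (p n)).real {G | P n G} := by
    filter_upwards [eventually_exists_params hε hδ hp] with n ⟨k, hpar, hbad⟩
    have h1 := one_sub_le_binomialRandom_real (p n) (P n) _ fun A hA =>
      ⟨hpar.globallyResilient hε rfl hA, hpar.locallyResilient hε rfl hA⟩
    linarith
  have hlim : Tendsto (fun n : ℕ => 1 - 2 * Real.exp (-(n : ℝ))) atTop (𝓝 1) := by
    have h0 : Tendsto (fun n : ℕ => Real.exp (-(n : ℝ))) atTop (𝓝 0) :=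
      Real.tendsto_exp_neg_atTop_nhds_zero.comp tendsto_natCast_atTop_atTop
    simpa using (h0.const_mul 2).const_sub 1
  have hreal : Tendsto (fun n : ℕ =>
      (SimpleGraph.binomialRandom (Fin n) (p n)).real {G | P n G}) atTop (𝓝 1) :=
    tendsto_of_tendsto_of_tendsto_of_le_of_le' hlim tendsto_const_nhds hlow
      (Eventually.of_forall fun n => MeasureTheory.measureReal_le_one)
  have h := ENNReal.tendsto_ofReal hreal
  rw [ENNReal.ofReal_one] at h
  exact h.congr fun n => MeasureTheory.ofReal_measureReal
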